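/- Let $F$ be the free group with free generators $x_1,\dots,x_k$, $k\ge 2$, and let $L>0$ be an integer divisible by $4$. A \emph{tagged loop} of length $L$ is a cyclically reduced cyclic word of length $L$ in the letters $x_i^{\pm1}$ together with one \emph{tag}: the germ of an edge, labelled by a letter and attached at one vertex of the loop, such that the labels of the three edges leaving that vertex are pairwise distinct. Let $S(L)$ be the finite set of tagged loops of length $L$, let $W(L)=\mathbb{Q}[S(L)]$, let $h:W(L)\to\mathbb{Q}^k$ be the linear map sending a loop to its homology class (its exponent sums), and let $V(L)=\ker h$, with the topology induced from the product topology on $\mathbb{Q}^{S(L)}$. Let $\mathbf 1\in W(L)$ be the vector all of whose coordinates are $1$. A \emph{(tagged) fatgraph} is a finite graph $Y$, possibly disconnected, with tags (half-open edge germs) at some vertices, a cyclic order of the edges and tags at each vertex, and a labelling of $Y$ by the letters (edges subdivided into unit edges, each labelled by one letter) which is folded, i.e. the labels of the edges and tags leaving any vertex are pairwise distinct. It fattens to an oriented surface $S(Y)$, whose boundary components are cyclic words with tags; all fatgraphs below have $\partial S(Y)$ a collection of loops in $S(L)$. Tags count as edges in the valence of a vertex; bivalent vertices are regarded as subdivision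 points, and $Y$ is trivalent if all other vertices have valence three. $Y$ is \emph{thin} if it is trivalent and its trivalent vertices (including those carrying a tag) are pairwise at distance at least $L/4$. A \emph{good pair of pants} is a trivalent fatgraph with $S(Y)$ a pair of pants, such that all edges between the trivalent vertices that carry no tag have length exactly $L/2$, and the tags lie on different edges, each at distance exactly $L/4$ from the trivalent vertices that carry no tag. A \emph{good annulus} is a fatgraph with $S(Y)$ an annulus whose two tags are at distance at least $L/4$. A vector in $W(L)$ \emph{bounds} a fatgraph (or a finite collection of fatgraphs) if its coordinate at each $s\in S(L)$ is the number of boundary components equal to $s$. Let $C(L)$ be the set of $v\in V(L)$ all of whose coordinates are positive and some positive rational multiple of which bounds a thin fatgraph. Then: \begin{enumerate} \item for every $v\in V(L)$ with integer coordinates there is $n\in\mathbb{N}$ such that $\frac{L}{2}v+n\mathbf 1$ bounds a finite collection of good pairs of pants and good annuli; \item $C(L)$ is full dimensional in $V(L)$, i.e. its affine span is $V(L)$; \item $\mathbf 1\in V(L)$ and $C(L)$ contains an open projective neighbourhood of $\mathbf 1$: an open subset of $V(L)$ that contains $\mathbf 1$ and is invariant under multiplication by positive rational numbers. \end{enumerate}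 -/

import Mathlib

namespace GoodPants

/-- Letters `x_a` (`(a, true)`) and `x_a⁻¹` (`(a, false)`) of the free group of rank `k`. -/
abbrev Letter (k : ℕ) : Type := Fin k × Bool

/-- The inverse letter. -/
def Letter.inv {k : ℕ} (x : Letter k) : Letter k := (x.1, !x.2)

/-- A tagged loop of length `L`: a cyclically reduced cyclic word of length `L` in the free group of
rank `k`, with one tag. The tag is the germ of an edge attached at one vertex of the loop, and `tag`
is the label of this germ read away from the loop. The word is written starting at the tagged
vertex, which picks one representative of every tagged cyclic word. The label of the germ is
compatible with the loop: the three outgoing labels at the tagged vertex (the first letter, the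
inverse of the last letter, the tag) are pairwise distinct. -/
@[ext]
structure TaggedLoop (k L : ℕ) where
  word : Fin L → Letter k
  tag : Letter k
  reduced : ∀ i : Fin L, word (finRotate L i) ≠ (word i).inv
  tag_ne_first : ∀ i : Fin L, i.val = 0 → tag ≠ word i
  tag_ne_last : ∀ i : Fin L, i.val + 1 = L → tag ≠ (word i).inv

noncomputable instance (k L : ℕ) : Fintype (TaggedLoop k L) :=
  Fintype.ofInjective (fun s : TaggedLoop k L => (s.word, s.tag)) (by
    intro s t h
    simp only [Prod.mk.injEq] at h
    exact TaggedLoop.ext h.1 h.2)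

/-- The homology class of a tagged loop in `ℤ^k`: the exponent sums of the generators. -/
def TaggedLoop.homology {k L : ℕ} (s : TaggedLoop k L) (a : Fin k) : ℤ :=
  ∑ i : Fin L, if (s.word i).1 = a then (if (s.word i).2 then 1 else -1) else 0

/-- The space `W(L)` of rational vectors of tagged loops of length `L`. -/
abbrev LoopSpace (k L : ℕ) : Type := TaggedLoop k L → ℚ

/-- The linear map that takes a vector of tagged loops to its homology class. -/
noncomputable def homologyMap (k L : ℕ) : LoopSpace k L →ₗ[ℚ] (Fin k → ℚ) where
  toFun v := fun a => ∑ s : TaggedLoop k L, v s * (s.homology a : ℚ)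
  map_add' v w := by
    funext a
    simp [add_mul, Finset.sum_add_distrib]
  map_smul' c v := by
    funext a
    simp [Finset.mul_sum, mul_assoc]

/-- The space `V(L)` of homologically trivial vectors. -/
noncomputable abbrev TrivialSpace (k L : ℕ) : Submodule ℚ (LoopSpace k L) :=
  LinearMap.ker (homologyMap k L)

/-- A (finite, partial) folded fatgraph with tags over the rose with `k` petals.
The graph is subdivided, so that every edge has length one and is labelled by one letter.
`H` is the set of half-edges. A half-edge `h` sits at the vertex `vert h`; `opp h` is the other half
of its edge, and `label h` is the letter read along the edge when leaving `vert h`. The half-edges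
fixed by `opp` are the tags: germs of edges that go on outside the fatgraph.
`next` is the cyclic order of the half-edges at each vertex; its cycles are the vertices. -/
structure TaggedFatgraph (k : ℕ) where
  V : Type
  H : Type
  finite_V : Finite V
  finite_H : Finite H
  vert : H → V
  opp : Equiv.Perm H
  next : Equiv.Perm H
  label : H → Letter k
  opp_opp : ∀ h, opp (opp h) = h
  label_opp : ∀ h, opp h ≠ h → label (opp h) = (label h).inv
  vert_surjective : Function.Surjective vert
  vert_eq_iff : ∀ h h', vert h = vert h' ↔ next.SameCycle h h'
  folded : ∀ h h', vert h = vert h' → label h = label h' → h = h'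

namespace TaggedFatgraph

variable {k : ℕ} (Y : TaggedFatgraph k)

/-- A half-edge that is a tag. -/
def IsTag (h : Y.H) : Prop := Y.opp h = h

/-- The boundary permutation. The boundary of the fattening `S(Y)` runs along `h` to its end and
then turns to the next half-edge there. A tag is its own opposite, so it is passed as a puncture of
the boundary word. The boundary components of `S(Y)` are the cycles of this permutation. -/
def bdry : Equiv.Perm Y.H := Y.next * Y.opp

/-- The boundary component through the tag `t` is the tagged loop `s`: from the tag on, the boundary
reads the word of `s`, without meeting another tag, and is then back at `t`. -/
def Reads {L : ℕ} (t : Y.H) (s : TaggedLoop k L) : Prop :=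
  Y.IsTag t ∧ Y.label t = s.tag ∧
  (∀ i : Fin L, ¬ Y.IsTag ((Y.bdry ^ (i.val + 1)) t) ∧
    Y.label ((Y.bdry ^ (i.val + 1)) t) = s.word i) ∧
  (Y.bdry ^ (L + 1)) t = t

/-- Every boundary component is a tagged loop of length `L` (with exactly one tag). -/
def BoundaryIn (L : ℕ) : Prop :=
  (∀ h, ∃ t, Y.IsTag t ∧ Y.bdry.SameCycle t h) ∧
  (∀ t, Y.IsTag t → ∃ s : TaggedLoop k L, Y.Reads t s)

/-- The boundary as a vector: how many boundary components are equal to each tagged loop.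
(Every component that is a tagged loop contains exactly one tag.) -/
noncomputable def boundary (L : ℕ) : LoopSpace k L :=
  fun s => (Nat.card {t : Y.H // Y.Reads t s} : ℚ)

/-- The valence of a vertex, tags included. -/
noncomputable def valence (v : Y.V) : ℕ := Nat.card {h : Y.H // Y.vert h = v}

/-- `Y` is trivalent: every vertex is a trivalent vertex (where tags count)
or a bivalent subdivision point. -/
def IsTrivalent : Prop := ∀ v, Y.valence v = 2 ∨ Y.valence v = 3

/-- Adjacency of the vertices, used for the graph distance (all edges have length one). -/
def graph : SimpleGraph Y.V :=
  SimpleGraph.fromRel (fun u v => ∃ h, Y.vert h = u ∧ Y.vert (Y.opp h) = v)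

/-- A thin fatgraph: the boundary is a collection of tagged loops of length `L`, `Y` is trivalent,
and the trivalent vertices, tags counted, are pairwise at distance at least `L / 4`. -/
def IsThin (L : ℕ) : Prop :=
  Y.BoundaryIn L ∧ Y.IsTrivalent ∧
  ∀ u v, u ≠ v → Y.valence u = 3 → Y.valence v = 3 → (L : ℕ∞) ≤ 4 * Y.graph.edist u v

/-- The number of boundary components of `S(Y)`. -/
noncomputable def numBoundary : ℕ := Nat.card (Quotient (Equiv.Perm.SameCycle.setoid Y.bdry))

/-- The Euler characteristic of `Y`: vertices minus edges. Two half-edges make one edge; tags do not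
count. -/
noncomputable def eulerChar : ℤ :=
  (Nat.card Y.V : ℤ) - ((Nat.card {h : Y.H // ¬ Y.IsTag h} / 2 : ℕ) : ℤ)

/-- `S(Y)` is an annulus: connected, with two boundary components and Euler characteristic `0`. -/
def IsAnnulus : Prop := Y.graph.Connected ∧ Y.numBoundary = 2 ∧ Y.eulerChar = 0

/-- `S(Y)` is a pair of pants: connected, with three boundary components and Euler characteristic
`-1`. -/
def IsPants : Prop := Y.graph.Connected ∧ Y.numBoundary = 3 ∧ Y.eulerChar = -1

/-- A vertex that carries a tag. -/
def HasTag (v : Y.V) : Prop := ∃ t, Y.vert t = v ∧ Y.IsTag t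

/-- A real trivalent vertex: a vertex of valence three without a tag. -/
def IsBranch (v : Y.V) : Prop := Y.valence v = 3 ∧ ¬ Y.HasTag v

/-- `p 0, …, p (m - 1)` are the successive unit edges of an edge of length `m` of `Y` in the
unsubdivided sense: a path without backtracking between real trivalent vertices, with no real
trivalent vertex in between. -/
def IsEdge (p : ℕ → Y.H) (m : ℕ) : Prop :=
  0 < m ∧ (∀ j < m, ¬ Y.IsTag (p j)) ∧
  Y.IsBranch (Y.vert (p 0)) ∧ Y.IsBranch (Y.vert (Y.opp (p (m - 1)))) ∧
  ∀ j, j + 1 < m → ¬ Y.IsBranch (Y.vert (p (j + 1))) ∧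
    Y.vert (p (j + 1)) = Y.vert (Y.opp (p j)) ∧ p (j + 1) ≠ Y.opp (p j)

/-- A good pair of pants: a trivalent pair of pants with boundary in the tagged loops of length `L`,
all edges of length exactly `L / 2`, and tags on different edges, exactly `L / 4` from the real
trivalent vertices (so the middle of each of the three edges carries one of the three tags, and no
other vertex carries a tag). -/
def IsGoodPants (L : ℕ) : Prop :=
  Y.IsPants ∧ Y.BoundaryIn L ∧ Y.IsTrivalent ∧
  ∀ p m, Y.IsEdge p m → 2 * m = L ∧
    ∀ j, 0 < j → j < m → (Y.HasTag (Y.vert (p j)) ↔ 4 * j = L)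

/-- A good annulus: a fatgraph annulus with boundary in the tagged loops of length `L`, whose tags
are at distance at least `L / 4`. -/
def IsGoodAnnulus (L : ℕ) : Prop :=
  Y.IsAnnulus ∧ Y.BoundaryIn L ∧
  ∀ s t, s ≠ t → Y.IsTag s → Y.IsTag t → (L : ℕ∞) ≤ 4 * Y.graph.edist (Y.vert s) (Y.vert t)

end TaggedFatgraph

/-- The vector `u` bounds a finite collection of good pants and good annuli. -/
def BoundsPantsAndAnnuli {k L : ℕ} (u : LoopSpace k L) : Prop :=
  ∃ (m : ℕ) (Y : Fin m → TaggedFatgraph k),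
    (∀ i, (Y i).IsGoodPants L ∨ (Y i).IsGoodAnnulus L) ∧ u = ∑ i, (Y i).boundary L

/-- The vector `u` bounds a thin fatgraph. -/
def BoundsThin {k L : ℕ} (u : LoopSpace k L) : Prop :=
  ∃ Y : TaggedFatgraph k, Y.IsThin L ∧ u = Y.boundary L

/-- The cone `C(L)`: the positive homologically trivial vectors that have a positive multiple which
bounds a thin fatgraph. -/
def thinCone (k L : ℕ) : Set (TrivialSpace k L) :=
  {v | (∀ s, 0 < (v : LoopSpace k L) s) ∧
    ∃ c : ℚ, 0 < c ∧ BoundsThin (c • (v : LoopSpace k L))}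

end GoodPants

/-! ### Letters, distances and valences in fatgraphs. -/

namespace GoodPants

/-! Good annuli and good pants can be glued from their boundary words. The fatgraphs obtained are
thin, and thin fatgraphs are closed under disjoint union. So everything reduces to showing that
`(L/2) z + n • 1` is a sum of such boundaries for every integral homologically trivial `z`.

Adding multiples of `1` turns this semigroup question into a group question. For a fixed offset of
the tags, the boundaries of all annuli add up to a multiple of `1`, because each word admits exactly
`2k - 2` tags (`sum_annuli`). Hence the negative of an annulus boundary is a sum of annulus
boundaries up to a multiple of `1`. The same follows for pants, since inverting the strands of a
pair of pants gives another one. It remains to work in the quotient of the integral vectors by the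
group generated by all boundaries.

In this quotient annuli of different offsets make the class `φ` of a loop independent of its tag and
base point, and make inversion act by `-1`. Let `m = L/2`. Pants give `φ(u v⁻¹) + φ(v w⁻¹) + φ(w
u⁻¹) = 0` for reduced words of length `m` that pairwise differ in their first and in their last
letters. So `φ(u v⁻¹)` is a cocycle on a graph of words. With at least four letters, the common
neighbours of a vertex and a base vertex are linked by triangles well enough to make every such
cocycle a coboundary (`exists_potential`): `φ(u v⁻¹) = f(u) - f(v)`.

Since `φ` is invariant under rotation, moving a window of length `m` by one letter changes `f` by a
quantity that depends only on the letter that leaves and the letter that enters. Sliding from one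
word to another gives `m f(u) = ∑ f(u_i ⋯ u_i)` (`potential_additive`), so `m φ` is a sum over
letters up to a constant and depends only on homology (`exists_additive_class`,
`nsmul_map_eq_zero`). Therefore `m z` is zero in the quotient for every homologically trivial `z`,
which is the first claim with its factor `L/2`.

For the other claims, `1` bounds virtually, and so does `v + t • 1` for every homologically trivial
`v` and some `t ≥ 0`. Applying this to plus and minus a basis gives an open cone around `1` in
`thinCone`, and an open set spans the whole space affinely. -/

theorem Letter.inv_inv {k : ℕ} (x : Letter k) : x.inv.inv = x := by
  simp [Letter.inv]

theorem Letter.inv_ne {k : ℕ} (x : Letter k) : x.inv ≠ x := by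
  intro h
  have := congrArg Prod.snd h
  simp [Letter.inv] at this

theorem Letter.inv_inj {k : ℕ} {x y : Letter k} : x.inv = y.inv ↔ x = y :=
  ⟨fun h => by rw [← x.inv_inv, h, y.inv_inv], fun h => h ▸ rfl⟩

theorem Letter.eq_inv_comm {k : ℕ} {x y : Letter k} : x = y.inv ↔ y = x.inv :=
  ⟨fun h => by rw [h, y.inv_inv], fun h => by rw [h, x.inv_inv]⟩

namespace TaggedFatgraph

variable {k : ℕ}

theorem vert_bdry (Y : TaggedFatgraph k) (h : Y.H) :
    Y.vert (Y.bdry h) = Y.vert (Y.opp h) := by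
  rw [Y.vert_eq_iff]
  refine (Equiv.Perm.SameCycle.refl _ _).symm.trans ?_ |>.symm
  exact ⟨1, by simp [bdry]⟩

theorem reachable_opp (Y : TaggedFatgraph k) (h : Y.H) :
    Y.graph.Reachable (Y.vert h) (Y.vert (Y.opp h)) := by
  by_cases e : Y.vert h = Y.vert (Y.opp h)
  · rw [← e]
  · exact SimpleGraph.Adj.reachable ((SimpleGraph.fromRel_adj _ _ _).2 ⟨e, Or.inl ⟨h, rfl, rfl⟩⟩)

theorem reachable_bdry (Y : TaggedFatgraph k) (h : Y.H) :
    Y.graph.Reachable (Y.vert h) (Y.vert (Y.bdry h)) := by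
  rw [vert_bdry]; exact Y.reachable_opp h

theorem le_edist_of_walk {Y : TaggedFatgraph k} {u v : Y.V} {L : ℕ}
    (h : ∀ p : Y.graph.Walk u v, L ≤ 4 * p.length) : (L : ℕ∞) ≤ 4 * Y.graph.edist u v := by
  by_cases hreach : Y.graph.Reachable u v
  · obtain ⟨p, hp⟩ := hreach.exists_walk_length_eq_edist
    rw [← hp]
    exact_mod_cast h p
  · rw [SimpleGraph.edist_eq_top_of_not_reachable hreach]
    simp

/-- A function on the vertices that changes by at most one along every edge bounds the distance
from below. -/
theorem le_edist_of_lipschitz (Y : TaggedFatgraph k) (r : Y.V → ℤ)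
    (hr : ∀ h, |r (Y.vert (Y.opp h)) - r (Y.vert h)| ≤ 1) {L : ℕ} (u v : Y.V)
    (huv : (L : ℤ) ≤ 4 * |r u - r v|) : (L : ℕ∞) ≤ 4 * Y.graph.edist u v := by
  have key : ∀ {u v : Y.V} (p : Y.graph.Walk u v), |r u - r v| ≤ p.length := by
    intro u v p
    induction p with
    | nil => simp
    | @cons u w v hadj p ih =>
      have h1 : |r u - r w| ≤ 1 := by
        rcases ((SimpleGraph.fromRel_adj _ _ _).1 hadj).2 with ⟨h, rfl, rfl⟩ | ⟨h, rfl, rfl⟩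
        · rw [abs_sub_comm]; exact hr h
        · exact hr h
      have := abs_sub_le (r u) (r w) (r v)
      rw [SimpleGraph.Walk.length_cons]
      push_cast
      linarith
  refine le_edist_of_walk fun p => ?_
  have := key p
  zify
  linarith

section Consecutive

/-- All half-edges at a vertex are consecutive in its cyclic order. -/
def Consecutive (Y : TaggedFatgraph k) : Prop :=
  ∀ h h', Y.vert h = Y.vert h' → h' = h ∨ h' = Y.next h ∨ h = Y.next h'

variable {Y : TaggedFatgraph k}

theorem vert_next (Y : TaggedFatgraph k) (h : Y.H) : Y.vert (Y.next h) = Y.vert h := by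
  rw [Y.vert_eq_iff]
  exact Equiv.Perm.SameCycle.symm ⟨1, by simp⟩

/-- A vertex has at most three half-edges under this condition, so its valence can be read off from
the first two iterates of `next`. -/
theorem Consecutive.fiber (hY : Y.Consecutive) (h : Y.H) :
    {h' | Y.vert h' = Y.vert h} = {h, Y.next h, Y.next.symm h} := by
  ext h'
  simp only [Set.mem_ofPred_eq, Set.mem_insert_iff, Set.mem_singleton_iff]
  constructor
  · intro e
    rcases hY h h' e.symm with e | e | e
    · exact Or.inl e
    · exact Or.inr (Or.inl e)
    · exact Or.inr (Or.inr (by rw [e]; simp))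
  · rintro (rfl | rfl | rfl)
    · rfl
    · exact Y.vert_next h
    · rw [← Y.vert_next, Equiv.apply_symm_apply]

theorem valence_eq_ncard (v : Y.V) : Y.valence v = {h | Y.vert h = v}.ncard := rfl

theorem Consecutive.valence_eq_two (hY : Y.Consecutive) {h : Y.H} (h1 : Y.next h ≠ h)
    (h2 : Y.next (Y.next h) = h) : Y.valence (Y.vert h) = 2 := by
  have e : Y.next.symm h = Y.next h := by rw [Equiv.symm_apply_eq, h2]
  rw [valence_eq_ncard, hY.fiber, e, Set.pair_eq_singleton, Set.ncard_pair h1.symm]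

theorem Consecutive.valence_eq_three (hY : Y.Consecutive) {h : Y.H} (h1 : Y.next h ≠ h)
    (h2 : Y.next (Y.next h) ≠ h) : Y.valence (Y.vert h) = 3 := by
  rw [valence_eq_ncard, hY.fiber, Set.ncard_eq_three]
  refine ⟨_, _, _, h1.symm, ?_, ?_, rfl⟩
  · intro e; rw [Equiv.eq_symm_apply] at e; exact h1 e
  · intro e; rw [Equiv.eq_symm_apply] at e; exact h2 e

theorem Consecutive.isTrivalent (hY : Y.Consecutive) (h1 : ∀ h, Y.next h ≠ h) :
    Y.IsTrivalent := by
  intro v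
  obtain ⟨h, rfl⟩ := Y.vert_surjective v
  by_cases h2 : Y.next (Y.next h) = h
  · exact Or.inl (hY.valence_eq_two (h1 h) h2)
  · exact Or.inr (hY.valence_eq_three (h1 h) h2)

end Consecutive

/-! ### Disjoint unions of fatgraphs. -/

section DisjointUnion

/-- The fatgraph without vertices. -/
def empty (k : ℕ) : TaggedFatgraph k where
  V := Empty
  H := Empty
  finite_V := inferInstance
  finite_H := inferInstance
  vert := id
  opp := 1
  next := 1
  label := Empty.elim
  opp_opp h := h.elim
  label_opp h := h.elim
  vert_surjective h := h.elim
  vert_eq_iff h := h.elim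
  folded h := h.elim

theorem isThin_empty (k L : ℕ) : (empty k).IsThin L :=
  ⟨⟨fun h => Empty.elim h, fun h => Empty.elim h⟩, fun v => Empty.elim v, fun v => Empty.elim v⟩

theorem boundary_empty (k L : ℕ) : (empty k).boundary L = 0 := by
  funext s
  have : IsEmpty {t : (empty k).H // (empty k).Reads t s} := ⟨fun t => Empty.elim t.1⟩
  simp [boundary]

theorem sumCongr_zpow_inl {α β : Type} (e : Equiv.Perm α) (f : Equiv.Perm β) (n : ℤ) (a : α) :
    ((Equiv.Perm.sumCongr e f) ^ n) (Sum.inl a) = Sum.inl ((e ^ n) a) := by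
  have : (Equiv.Perm.sumCongr e f) ^ n = Equiv.Perm.sumCongr (e ^ n) (f ^ n) :=
    (map_zpow (Equiv.Perm.sumCongrHom α β) (e, f) n).symm
  rw [this]; rfl

theorem sumCongr_zpow_inr {α β : Type} (e : Equiv.Perm α) (f : Equiv.Perm β) (n : ℤ) (b : β) :
    ((Equiv.Perm.sumCongr e f) ^ n) (Sum.inr b) = Sum.inr ((f ^ n) b) := by
  have : (Equiv.Perm.sumCongr e f) ^ n = Equiv.Perm.sumCongr (e ^ n) (f ^ n) :=
    (map_zpow (Equiv.Perm.sumCongrHom α β) (e, f) n).symm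
  rw [this]; rfl

/-- The disjoint union of two fatgraphs. -/
def disjUnion (Y Z : TaggedFatgraph k) : TaggedFatgraph k where
  V := Y.V ⊕ Z.V
  H := Y.H ⊕ Z.H
  finite_V := by have := Y.finite_V; have := Z.finite_V; infer_instance
  finite_H := by have := Y.finite_H; have := Z.finite_H; infer_instance
  vert := Sum.map Y.vert Z.vert
  opp := Equiv.Perm.sumCongr Y.opp Z.opp
  next := Equiv.Perm.sumCongr Y.next Z.next
  label := Sum.elim Y.label Z.label
  opp_opp := by rintro (h | h) <;> simp [Y.opp_opp, Z.opp_opp]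
  label_opp := by
    rintro (h | h) e
    · exact Y.label_opp h fun e' => e (congrArg Sum.inl e')
    · exact Z.label_opp h fun e' => e (congrArg Sum.inr e')
  vert_surjective := Sum.map_surjective.2 ⟨Y.vert_surjective, Z.vert_surjective⟩
  vert_eq_iff := by
    rintro (h | h) (h' | h')
    · simp [Equiv.Perm.SameCycle, sumCongr_zpow_inl, Y.vert_eq_iff]
    · simp [Equiv.Perm.SameCycle, sumCongr_zpow_inl]
    · simp [Equiv.Perm.SameCycle, sumCongr_zpow_inr]
    · simp [Equiv.Perm.SameCycle, sumCongr_zpow_inr, Z.vert_eq_iff]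
  folded := by
    rintro (h | h) (h' | h') e1 e2
    · exact congrArg Sum.inl (Y.folded _ _ (Sum.inl_injective e1) e2)
    · exact absurd e1 (by simp)
    · exact absurd e1 (by simp)
    · exact congrArg Sum.inr (Z.folded _ _ (Sum.inr_injective e1) e2)

variable (Y Z : TaggedFatgraph k)

theorem disjUnion_bdry : (Y.disjUnion Z).bdry = Equiv.Perm.sumCongr Y.bdry Z.bdry :=
  Equiv.Perm.sumCongr_mul _ _ _ _

theorem disjUnion_bdry_pow_inl (n : ℕ) (h : Y.H) :
    ((Y.disjUnion Z).bdry ^ n) (Sum.inl h) = Sum.inl ((Y.bdry ^ n) h) := by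
  rw [disjUnion_bdry]; exact_mod_cast sumCongr_zpow_inl Y.bdry Z.bdry n h

theorem disjUnion_bdry_pow_inr (n : ℕ) (h : Z.H) :
    ((Y.disjUnion Z).bdry ^ n) (Sum.inr h) = Sum.inr ((Z.bdry ^ n) h) := by
  rw [disjUnion_bdry]; exact_mod_cast sumCongr_zpow_inr Y.bdry Z.bdry n h

theorem disjUnion_isTag_inl (h : Y.H) : (Y.disjUnion Z).IsTag (Sum.inl h) ↔ Y.IsTag h :=
  Sum.inl_injective.eq_iff

theorem disjUnion_isTag_inr (h : Z.H) : (Y.disjUnion Z).IsTag (Sum.inr h) ↔ Z.IsTag h :=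
  Sum.inr_injective.eq_iff

theorem disjUnion_reads_inl {L : ℕ} (h : Y.H) (s : TaggedLoop k L) :
    (Y.disjUnion Z).Reads (Sum.inl h) s ↔ Y.Reads h s := by
  simp only [Reads, disjUnion_bdry_pow_inl, disjUnion_isTag_inl]
  exact and_congr_right fun _ => and_congr_right fun _ => and_congr_right fun _ =>
    Sum.inl_injective.eq_iff

theorem disjUnion_reads_inr {L : ℕ} (h : Z.H) (s : TaggedLoop k L) :
    (Y.disjUnion Z).Reads (Sum.inr h) s ↔ Z.Reads h s := by
  simp only [Reads, disjUnion_bdry_pow_inr, disjUnion_isTag_inr]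
  exact and_congr_right fun _ => and_congr_right fun _ => and_congr_right fun _ =>
    Sum.inr_injective.eq_iff

theorem disjUnion_boundary (L : ℕ) :
    (Y.disjUnion Z).boundary L = Y.boundary L + Z.boundary L := by
  funext s
  have := Y.finite_H
  have := Z.finite_H
  have e : {t : (Y.disjUnion Z).H // (Y.disjUnion Z).Reads t s} ≃
      {t : Y.H // Y.Reads t s} ⊕ {t : Z.H // Z.Reads t s} :=
    (Equiv.subtypeSum (p := fun t => (Y.disjUnion Z).Reads t s)).trans
      (Equiv.sumCongr
        (Equiv.subtypeEquivRight fun t => disjUnion_reads_inl Y Z t s)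
        (Equiv.subtypeEquivRight fun t => disjUnion_reads_inr Y Z t s))
  simp only [boundary, Pi.add_apply]
  rw [Nat.card_congr e, Nat.card_sum]
  push_cast
  rfl

theorem disjUnion_valence_inl (v : Y.V) :
    (Y.disjUnion Z).valence (Sum.inl v) = Y.valence v := by
  refine Nat.card_congr ((Equiv.subtypeSum
    (p := fun h => (Y.disjUnion Z).vert h = Sum.inl v)).trans ?_)
  have : IsEmpty {b : Z.H // (Y.disjUnion Z).vert (Sum.inr b) = Sum.inl v} :=
    ⟨fun b => Sum.inr_ne_inl b.2⟩
  exact (Equiv.sumEmpty _ _).trans (Equiv.subtypeEquivRight fun _ => Sum.inl_injective.eq_iff)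

theorem disjUnion_valence_inr (v : Z.V) :
    (Y.disjUnion Z).valence (Sum.inr v) = Z.valence v := by
  refine Nat.card_congr ((Equiv.subtypeSum
    (p := fun h => (Y.disjUnion Z).vert h = Sum.inr v)).trans ?_)
  have : IsEmpty {b : Y.H // (Y.disjUnion Z).vert (Sum.inl b) = Sum.inr v} :=
    ⟨fun b => Sum.inl_ne_inr b.2⟩
  exact (Equiv.emptySum _ _).trans (Equiv.subtypeEquivRight fun _ => Sum.inr_injective.eq_iff)

theorem disjUnion_adj_inl {u : Y.V} {y : (Y.disjUnion Z).V}
    (hadj : (Y.disjUnion Z).graph.Adj (Sum.inl u) y) : ∃ v, y = Sum.inl v ∧ Y.graph.Adj u v := by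
  obtain ⟨hne, hadj⟩ := (SimpleGraph.fromRel_adj _ _ _).1 hadj
  rcases hadj with ⟨h | h, e1, e2⟩ | ⟨h | h, e1, e2⟩
  · obtain rfl : Y.vert h = u := Sum.inl_injective e1
    exact ⟨_, e2.symm, (SimpleGraph.fromRel_adj _ _ _).2
      ⟨fun e => hne (e2 ▸ congrArg Sum.inl e), Or.inl ⟨h, rfl, rfl⟩⟩⟩
  · exact absurd e1 Sum.inr_ne_inl
  · obtain rfl : Y.vert (Y.opp h) = u := Sum.inl_injective e2
    exact ⟨_, e1.symm, (SimpleGraph.fromRel_adj _ _ _).2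
      ⟨fun e => hne (e1 ▸ congrArg Sum.inl e), Or.inr ⟨h, rfl, rfl⟩⟩⟩
  · exact absurd e2 Sum.inr_ne_inl

theorem disjUnion_adj_inr {u : Z.V} {y : (Y.disjUnion Z).V}
    (hadj : (Y.disjUnion Z).graph.Adj (Sum.inr u) y) : ∃ v, y = Sum.inr v ∧ Z.graph.Adj u v := by
  obtain ⟨hne, hadj⟩ := (SimpleGraph.fromRel_adj _ _ _).1 hadj
  rcases hadj with ⟨h | h, e1, e2⟩ | ⟨h | h, e1, e2⟩
  · exact absurd e1 Sum.inl_ne_inr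
  · obtain rfl : Z.vert h = u := Sum.inr_injective e1
    exact ⟨_, e2.symm, (SimpleGraph.fromRel_adj _ _ _).2
      ⟨fun e => hne (e2 ▸ congrArg Sum.inr e), Or.inl ⟨h, rfl, rfl⟩⟩⟩
  · exact absurd e2 Sum.inl_ne_inr
  · obtain rfl : Z.vert (Z.opp h) = u := Sum.inr_injective e2
    exact ⟨_, e1.symm, (SimpleGraph.fromRel_adj _ _ _).2
      ⟨fun e => hne (e1 ▸ congrArg Sum.inr e), Or.inr ⟨h, rfl, rfl⟩⟩⟩

/-- Walks stay in the summand where they start. Thus lower bounds for distances carry over, and no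
condition arises between vertices of different summands. -/
theorem disjUnion_walk_inl {x y : (Y.disjUnion Z).V} (p : (Y.disjUnion Z).graph.Walk x y) :
    ∀ u, x = Sum.inl u → ∃ v, y = Sum.inl v ∧ ∃ q : Y.graph.Walk u v, q.length = p.length := by
  induction p with
  | nil => exact fun u hu => ⟨u, hu, .nil, rfl⟩
  | cons h p ih =>
    rintro u rfl
    obtain ⟨w, rfl, hw⟩ := disjUnion_adj_inl Y Z h
    obtain ⟨v, rfl, q, hq⟩ := ih w rfl
    exact ⟨v, rfl, .cons hw q, congrArg (· + 1) hq⟩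

theorem disjUnion_walk_inr {x y : (Y.disjUnion Z).V} (p : (Y.disjUnion Z).graph.Walk x y) :
    ∀ u, x = Sum.inr u → ∃ v, y = Sum.inr v ∧ ∃ q : Z.graph.Walk u v, q.length = p.length := by
  induction p with
  | nil => exact fun u hu => ⟨u, hu, .nil, rfl⟩
  | cons h p ih =>
    rintro u rfl
    obtain ⟨w, rfl, hw⟩ := disjUnion_adj_inr Y Z h
    obtain ⟨v, rfl, q, hq⟩ := ih w rfl
    exact ⟨v, rfl, .cons hw q, congrArg (· + 1) hq⟩

theorem le_walk_of_edist {Y : TaggedFatgraph k} {u v : Y.V} {L : ℕ}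
    (h : (L : ℕ∞) ≤ 4 * Y.graph.edist u v) (p : Y.graph.Walk u v) : L ≤ 4 * p.length := by
  have h2 : (L : ℕ∞) ≤ 4 * p.length :=
    h.trans (mul_le_mul_right (SimpleGraph.edist_le p) 4)
  exact_mod_cast h2

theorem disjUnion_sameCycle_inl {h h' : Y.H} (e : Y.bdry.SameCycle h h') :
    (Y.disjUnion Z).bdry.SameCycle (Sum.inl h) (Sum.inl h') := by
  obtain ⟨n, rfl⟩ := e
  exact ⟨n, by rw [disjUnion_bdry]; exact sumCongr_zpow_inl _ _ _ _⟩

theorem disjUnion_sameCycle_inr {h h' : Z.H} (e : Z.bdry.SameCycle h h') :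
    (Y.disjUnion Z).bdry.SameCycle (Sum.inr h) (Sum.inr h') := by
  obtain ⟨n, rfl⟩ := e
  exact ⟨n, by rw [disjUnion_bdry]; exact sumCongr_zpow_inr _ _ _ _⟩

variable {Y Z}

theorem IsThin.disjUnion {L : ℕ} (hY : Y.IsThin L) (hZ : Z.IsThin L) :
    (Y.disjUnion Z).IsThin L := by
  obtain ⟨⟨hY1, hY2⟩, hY3, hY4⟩ := hY
  obtain ⟨⟨hZ1, hZ2⟩, hZ3, hZ4⟩ := hZ
  refine ⟨⟨?_, ?_⟩, ?_, ?_⟩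
  · rintro (h | h)
    · obtain ⟨t, ht, e⟩ := hY1 h
      exact ⟨Sum.inl t, (disjUnion_isTag_inl Y Z t).2 ht, disjUnion_sameCycle_inl Y Z e⟩
    · obtain ⟨t, ht, e⟩ := hZ1 h
      exact ⟨Sum.inr t, (disjUnion_isTag_inr Y Z t).2 ht, disjUnion_sameCycle_inr Y Z e⟩
  · rintro (t | t) ht
    · obtain ⟨s, hs⟩ := hY2 t ((disjUnion_isTag_inl Y Z t).1 ht)
      exact ⟨s, (disjUnion_reads_inl Y Z t s).2 hs⟩
    · obtain ⟨s, hs⟩ := hZ2 t ((disjUnion_isTag_inr Y Z t).1 ht)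
      exact ⟨s, (disjUnion_reads_inr Y Z t s).2 hs⟩
  · rintro (v | v)
    · rw [disjUnion_valence_inl]; exact hY3 v
    · rw [disjUnion_valence_inr]; exact hZ3 v
  · rintro (u | u) v huv hu hv
    · refine le_edist_of_walk fun p => ?_
      obtain ⟨w, rfl, q, hq⟩ := disjUnion_walk_inl Y Z p u rfl
      rw [disjUnion_valence_inl] at hu hv
      rw [← hq]
      exact le_walk_of_edist (hY4 u w (fun e => huv (e ▸ rfl)) hu hv) q
    · refine le_edist_of_walk fun p => ?_
      obtain ⟨w, rfl, q, hq⟩ := disjUnion_walk_inr Y Z p u rfl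
      rw [disjUnion_valence_inr] at hu hv
      rw [← hq]
      exact le_walk_of_edist (hZ4 u w (fun e => huv (e ▸ rfl)) hu hv) q

end DisjointUnion

end TaggedFatgraph

theorem BoundsThin.add {k L : ℕ} {u v : LoopSpace k L} (hu : BoundsThin u) (hv : BoundsThin v) :
    BoundsThin (u + v) := by
  obtain ⟨Y, hY, rfl⟩ := hu
  obtain ⟨Z, hZ, rfl⟩ := hv
  exact ⟨Y.disjUnion Z, hY.disjUnion hZ, (Y.disjUnion_boundary Z L).symm⟩

theorem BoundsThin.zero {k L : ℕ} : BoundsThin (0 : LoopSpace k L) :=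
  ⟨.empty k, TaggedFatgraph.isThin_empty k L, (TaggedFatgraph.boundary_empty k L).symm⟩

theorem BoundsPantsAndAnnuli.add {k L : ℕ} {u v : LoopSpace k L} (hu : BoundsPantsAndAnnuli u)
    (hv : BoundsPantsAndAnnuli v) : BoundsPantsAndAnnuli (u + v) := by
  obtain ⟨m, Y, hY, rfl⟩ := hu
  obtain ⟨n, Z, hZ, rfl⟩ := hv
  refine ⟨m + n, Fin.append Y Z, ?_, ?_⟩
  · intro i
    refine Fin.addCases (fun i => ?_) (fun i => ?_) i
    · simpa using hY i
    · simpa using hZ i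
  · rw [Fin.sum_univ_add]
    simp

theorem BoundsPantsAndAnnuli.zero {k L : ℕ} : BoundsPantsAndAnnuli (0 : LoopSpace k L) :=
  ⟨0, Fin.elim0, fun i => i.elim0, by simp⟩

end GoodPants

/-! ### Fatgraphs glued from tagged loops. -/

namespace GoodPants

variable {k L : ℕ}

noncomputable instance : DecidableEq (TaggedLoop k L) := Classical.decEq _

/-- The label of the half-edge at position `i` of a loop: the tag at position `0`, then the
letters of the word. -/
def TaggedLoop.labelAt (s : TaggedLoop k L) (i : Fin (L + 1)) : Letter k :=
  Fin.cases s.tag s.word i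

@[simp] theorem TaggedLoop.labelAt_succ (s : TaggedLoop k L) (i : Fin L) :
    s.labelAt i.succ = s.word i := rfl

theorem val_finRotate {n : ℕ} (i : Fin n) :
    (finRotate n i).val = if i.val + 1 = n then 0 else i.val + 1 := by
  obtain ⟨n, rfl⟩ : ∃ m, n = m + 1 := ⟨n - 1, by have := i.2; omega⟩
  split_ifs with h
  · rw [show i = Fin.last n from Fin.ext (by simp; omega), finRotate_last]; rfl
  · exact coe_finRotate_of_ne_last fun e => h (by rw [e]; simp)

theorem TaggedLoop.labelAt_rotate_zero (s : TaggedLoop k L) (hL : 0 < L) :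
    s.labelAt (finRotate (L + 1) 0) ≠ s.labelAt 0 := by
  have : finRotate (L + 1) 0 = Fin.succ ⟨0, hL⟩ := by
    ext
    rw [val_finRotate]
    simp
    omega
  rw [this, labelAt_succ]
  exact (s.tag_ne_first _ rfl).symm

/-- With the tag written in front of the word, reducedness and compatibility of the tag with the
last letter become a single condition on successive positions. -/
theorem TaggedLoop.labelAt_rotate_succ (s : TaggedLoop k L) (i : Fin L) :
    s.labelAt (finRotate (L + 1) i.succ) ≠ (s.labelAt i.succ).inv := by
  rw [labelAt_succ]
  by_cases h : i.val + 1 = L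
  · have : finRotate (L + 1) i.succ = 0 := by
      ext
      rw [val_finRotate]
      simp [h]
    rw [this]
    exact s.tag_ne_last i h
  · have : finRotate (L + 1) i.succ = (finRotate L i).succ := by
      ext
      rw [val_finRotate, Fin.val_succ, Fin.val_succ, val_finRotate, if_neg h, if_neg (by omega)]
    rw [this]
    exact s.reduced i

/-- A pairing of the letters of a family of tagged loops, with the data that identifies the
vertices of the fatgraph that results from gluing the loops along it. The half-edge `(j, i)` is the
tag of the loop `j` for `i = 0`, and otherwise its letter number `i - 1`. -/
structure Gluing (k L : ℕ) where
  L_pos : 0 < L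
  J : Type
  finite_J : Finite J
  loop : J → TaggedLoop k L
  opp : Equiv.Perm (J × Fin (L + 1))
  opp_opp : ∀ h, opp (opp h) = h
  opp_eq_iff : ∀ h, opp h = h ↔ h.2 = 0
  label_opp : ∀ j (i : Fin L),
    (loop (opp (j, i.succ)).1).labelAt (opp (j, i.succ)).2 = ((loop j).word i).inv
  V : Type
  vert : J × Fin (L + 1) → V
  vert_surjective : Function.Surjective vert
  vert_rotate : ∀ j i, vert (j, finRotate (L + 1) i) = vert (opp (j, i))
  consecutive : ∀ h h', vert h = vert h' → h' = h ∨
    h' = ((opp h).1, finRotate (L + 1) (opp h).2) ∨ h = ((opp h').1, finRotate (L + 1) (opp h').2)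

namespace Gluing

variable (G : Gluing k L)

/-- The permutation that runs along every loop. -/
def rot (J : Type) (L : ℕ) : Equiv.Perm (J × Fin (L + 1)) :=
  Equiv.prodCongr (Equiv.refl J) (finRotate (L + 1))

theorem rot_apply (J : Type) (j : J) (i : Fin (L + 1)) :
    rot J L (j, i) = (j, finRotate (L + 1) i) := rfl

theorem rot_pow (J : Type) (n : ℕ) (j : J) (i : Fin (L + 1)) :
    ((rot J L) ^ n) (j, i) = (j, i + Fin.ofNat (L + 1) n) := by
  induction n generalizing i with
  | zero => simp
  | succ n ih =>
    rw [pow_succ, Equiv.Perm.mul_apply, rot_apply, ih, finRotate_apply]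
    congr 1
    ext
    simp [Fin.val_add]
    congr 1
    ring

/-- Foldedness is a local condition on the boundary words: `opp h` carries the inverse label of `h`,
and the half-edge after `opp h` on its loop cannot carry that inverse again. A tag is instead
followed by the first letter of its own loop. -/
theorem label_next (h : G.J × Fin (L + 1)) :
    (G.loop (rot G.J L (G.opp h)).1).labelAt (rot G.J L (G.opp h)).2 ≠
      (G.loop h.1).labelAt h.2 := by
  obtain ⟨j, i⟩ := h
  induction i using Fin.cases with
  | zero =>
    rw [(G.opp_eq_iff (j, 0)).2 rfl]
    exact (G.loop j).labelAt_rotate_zero G.L_pos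
  | succ i =>
    have e := G.label_opp j i
    have hne : (G.opp (j, i.succ)).2 ≠ 0 := by
      intro h0
      have := (G.opp_eq_iff _).2 h0
      rw [G.opp_opp] at this
      rw [← this] at h0
      exact Fin.succ_ne_zero _ h0
    generalize G.opp (j, i.succ) = h' at e hne
    obtain ⟨j', i'⟩ := h'
    obtain ⟨i', rfl⟩ := Fin.exists_succ_eq_of_ne_zero hne
    intro h2
    refine (G.loop j').labelAt_rotate_succ i' ?_
    rw [Letter.eq_inv_comm] at e
    rw [labelAt_succ_eq] at h2
    exact h2.trans e
where
  labelAt_succ_eq {j : G.J} {i : Fin L} : (G.loop (j, i.succ).1).labelAt (j, i.succ).2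
    = (G.loop j).word i := rfl

/-- The fatgraph of a gluing. -/
def fatgraph : TaggedFatgraph k where
  V := G.V
  H := G.J × Fin (L + 1)
  finite_V := have := G.finite_J; Finite.of_surjective _ G.vert_surjective
  finite_H := have := G.finite_J; inferInstance
  vert := G.vert
  opp := G.opp
  next := rot G.J L * G.opp
  label h := (G.loop h.1).labelAt h.2
  opp_opp := G.opp_opp
  label_opp := by
    rintro ⟨j, i⟩ hi
    obtain ⟨i, rfl⟩ := Fin.exists_succ_eq_of_ne_zero fun h0 => hi ((G.opp_eq_iff _).2 h0)
    exact G.label_opp j i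
  vert_surjective := G.vert_surjective
  vert_eq_iff := by
    intro h h'
    have hv : ∀ h, G.vert ((rot G.J L * G.opp) h) = G.vert h := by
      intro h
      rw [Equiv.Perm.mul_apply]
      have := G.vert_rotate (G.opp h).1 (G.opp h).2
      rw [Prod.mk.eta, G.opp_opp] at this
      exact this
    constructor
    · intro e
      rcases G.consecutive h h' e with rfl | rfl | rfl
      · exact Equiv.Perm.SameCycle.refl _ _
      · exact ⟨1, rfl⟩
      · exact Equiv.Perm.SameCycle.symm ⟨1, rfl⟩
    · rintro ⟨n, rfl⟩
      induction n using Int.induction_on with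
      | zero => rfl
      | succ n ih => rw [add_comm (n : ℤ), zpow_one_add, Equiv.Perm.mul_apply, hv, ih]
      | pred n ih =>
        rw [ih, ← hv (((rot G.J L * G.opp) ^ (-(n : ℤ) - 1)) h), ← Equiv.Perm.mul_apply,
          ← zpow_one_add]
        congr 4
        ring
  folded := by
    intro h h' e1 e2
    rcases G.consecutive h h' e1 with rfl | rfl | rfl
    · rfl
    · exact absurd e2.symm (G.label_next h)
    · exact absurd e2 (G.label_next h')

theorem fatgraph_next (h : G.J × Fin (L + 1)) :
    G.fatgraph.next h = ((G.opp h).1, finRotate (L + 1) (G.opp h).2) := rfl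

/-- The cyclic order at the vertices is defined as `rot * opp` precisely so that the two copies of
`opp` cancel here. The boundary components are then the given loops by construction. -/
theorem fatgraph_bdry : G.fatgraph.bdry = rot G.J L := by
  ext1 h
  exact congrArg (rot G.J L) (G.opp_opp h)

theorem fatgraph_isTag (h : G.J × Fin (L + 1)) : G.fatgraph.IsTag h ↔ h.2 = 0 := G.opp_eq_iff h

theorem fatgraph_next_ne (h : G.J × Fin (L + 1)) : G.fatgraph.next h ≠ h := by
  intro e
  apply G.label_next h
  change rot G.J L (G.opp h) = h at e
  rw [e]

theorem fatgraph_consecutive : G.fatgraph.Consecutive := G.consecutive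

theorem fatgraph_isTrivalent : G.fatgraph.IsTrivalent :=
  G.fatgraph_consecutive.isTrivalent G.fatgraph_next_ne

theorem fatgraph_reads (j : G.J) : G.fatgraph.Reads ((j, 0) : G.J × Fin (L + 1)) (G.loop j) := by
  refine ⟨(G.fatgraph_isTag _).2 rfl, rfl, ?_, ?_⟩
  · intro i
    have e : (G.fatgraph.bdry ^ (i.val + 1)) ((j, 0) : G.J × Fin (L + 1)) = (j, i.succ) := by
      rw [fatgraph_bdry]
      refine (rot_pow _ _ _ _).trans ?_
      congr 1
      ext
      simp
    rw [e]
    exact ⟨fun h => Fin.succ_ne_zero _ ((G.fatgraph_isTag _).1 h), rfl⟩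
  · rw [fatgraph_bdry]
    refine (rot_pow _ _ _ _).trans ?_
    congr 1
    ext
    simp

theorem fatgraph_sameCycle (j : G.J) (i : Fin (L + 1)) :
    G.fatgraph.bdry.SameCycle ((j, 0) : G.J × Fin (L + 1)) ((j, i) : G.J × Fin (L + 1)) := by
  refine ⟨(i.val : ℤ), ?_⟩
  rw [fatgraph_bdry]
  refine (congrArg (fun e : Equiv.Perm (G.J × Fin (L + 1)) => e (j, 0))
    (zpow_natCast (rot G.J L) i.val)).trans ((rot_pow _ _ _ _).trans ?_)
  simp

theorem fatgraph_boundaryIn : G.fatgraph.BoundaryIn L := by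
  refine ⟨?_, ?_⟩
  · rintro ⟨j, i⟩
    exact ⟨(j, 0), (G.fatgraph_isTag _).2 rfl, G.fatgraph_sameCycle j i⟩
  · rintro ⟨j, i⟩ h
    obtain rfl : i = 0 := (G.fatgraph_isTag _).1 h
    exact ⟨_, G.fatgraph_reads j⟩

theorem Reads.unique {Y : TaggedFatgraph k} {t : Y.H} {s s' : TaggedLoop k L} (h : Y.Reads t s)
    (h' : Y.Reads t s') : s = s' := by
  ext1
  · funext i
    exact (h.2.2.1 i).2.symm.trans (h'.2.2.1 i).2
  · exact h.2.1.symm.trans h'.2.1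

theorem fatgraph_boundary [Fintype G.J] :
    G.fatgraph.boundary L = ∑ j, Pi.single (G.loop j) (1 : ℚ) := by
  funext s
  have e : {t : G.fatgraph.H // G.fatgraph.Reads t s} ≃ {j : G.J // G.loop j = s} :=
    { toFun := fun t => ⟨t.1.1, by
        have h2 : t.1.2 = 0 := (G.fatgraph_isTag _).1 t.2.1
        have h3 : t.1 = (t.1.1, (0 : Fin (L + 1))) := Prod.ext rfl h2
        have h4 := G.fatgraph_reads t.1.1
        rw [← h3] at h4
        exact Reads.unique h4 t.2⟩
      invFun := fun j => ⟨((j.1, 0) : G.J × Fin (L + 1)), by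
        have := G.fatgraph_reads j.1
        rwa [j.2] at this⟩
      left_inv := fun t => Subtype.ext (Prod.ext rfl ((G.fatgraph_isTag _).1 t.2.1).symm)
      right_inv := fun j => rfl }
  simp only [TaggedFatgraph.boundary]
  rw [Nat.card_congr e, Nat.card_eq_fintype_card, Fintype.card_subtype, Finset.sum_apply]
  simp only [Pi.single_apply]
  rw [Finset.sum_boole]
  simp [eq_comm]

theorem fatgraph_numBoundary : G.fatgraph.numBoundary = Nat.card G.J := by
  refine Nat.card_congr
    { toFun := Quotient.lift (fun h : G.J × Fin (L + 1) => h.1) ?_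
      invFun := fun j => Quotient.mk _ ((j, 0) : G.J × Fin (L + 1))
      left_inv := ?_
      right_inv := fun _ => rfl }
  · rintro ⟨a, i⟩ b ⟨n, hn⟩
    rw [fatgraph_bdry] at hn
    have : ∀ h : G.J × Fin (L + 1), ((rot G.J L) ^ n) h = (h.1, ((finRotate (L + 1)) ^ n) h.2) := by
      have h2 : (rot G.J L) ^ n = Equiv.prodCongr (Equiv.refl G.J) ((finRotate (L + 1)) ^ n) := by
        clear hn
        induction n using Int.induction_on with
        | zero => rfl
        | succ n ih => rw [zpow_add_one, ih, zpow_add_one]; rfl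
        | pred n ih => rw [zpow_sub_one, ih, zpow_sub_one]; rfl
      intro h; rw [h2]; rfl
    rw [← hn]
    exact (congrArg Prod.fst (this (a, i))).symm
  · intro q
    induction q using Quotient.inductionOn with
    | h h => exact Quotient.sound (G.fatgraph_sameCycle h.1 h.2)

theorem fatgraph_eulerChar : G.fatgraph.eulerChar = Nat.card G.V - (Nat.card G.J * L / 2 : ℕ) := by
  have e : {h : G.fatgraph.H // ¬ G.fatgraph.IsTag h} ≃ G.J × Fin L :=
    { toFun := fun h => ((h.1 : G.J × Fin (L + 1)).1, Fin.pred (h.1 : G.J × Fin (L + 1)).2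
        fun h0 => h.2 ((G.fatgraph_isTag _).2 h0))
      invFun := fun h => ⟨((h.1, h.2.succ) : G.J × Fin (L + 1)), fun h0 =>
        Fin.succ_ne_zero _ ((G.fatgraph_isTag _).1 h0)⟩
      left_inv := fun h => Subtype.ext (Prod.ext rfl (Fin.succ_pred _
        fun h0 => h.2 ((G.fatgraph_isTag _).2 h0)))
      right_inv := fun h => rfl }
  simp only [TaggedFatgraph.eulerChar]
  rw [Nat.card_congr e, Nat.card_prod, Nat.card_eq_fintype_card (α := Fin L), Fintype.card_fin]
  rfl

theorem fatgraph_reachable (j : G.J) (i i' : Fin (L + 1)) :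
    G.fatgraph.graph.Reachable (G.vert (j, i)) (G.vert (j, i')) := by
  have key : ∀ n : ℕ, ∀ i : Fin (L + 1), G.fatgraph.graph.Reachable (G.vert (j, i))
      (G.vert (((rot G.J L) ^ n) (j, i))) := by
    intro n
    induction n with
    | zero => exact fun i => SimpleGraph.Reachable.refl _
    | succ n ih =>
      intro i
      refine (ih i).trans ?_
      rw [pow_succ', Equiv.Perm.mul_apply, ← fatgraph_bdry]
      exact G.fatgraph.reachable_bdry _
  have h0 : ∀ i, G.fatgraph.graph.Reachable (G.vert (j, 0)) (G.vert (j, i)) := by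
    intro i
    have := key i.val 0
    rw [rot_pow] at this
    simpa using this
  exact (h0 i).symm.trans (h0 i')

theorem fatgraph_connected [Nonempty G.J] (hr : ∀ j j', Relation.ReflTransGen
    (fun a b => ∃ i, (G.opp (a, i)).1 = b) j j') : G.fatgraph.graph.Connected := by
  have key : ∀ j j' i i', G.fatgraph.graph.Reachable (G.vert (j, i)) (G.vert (j', i')) := by
    intro j j'
    induction hr j j' with
    | refl => exact G.fatgraph_reachable j
    | @tail b c _ h ih =>
      intro i i'
      obtain ⟨a, rfl⟩ := h
      exact ((ih i a).trans (G.fatgraph.reachable_opp ((b, a) : G.J × Fin (L + 1)))).trans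
        (G.fatgraph_reachable _ _ _)
  refine (SimpleGraph.connected_iff _).2 ⟨?_, ⟨G.vert (Classical.arbitrary _, 0)⟩⟩
  intro u v
  obtain ⟨h, rfl⟩ := G.vert_surjective u
  obtain ⟨h', rfl⟩ := G.vert_surjective v
  exact key _ _ _ _

end Gluing
end GoodPants

/-! ### Good annuli. -/

namespace GoodPants

variable {k L : ℕ}

/-- The position of the letter opposite to the letter at position `i`, when two loops are glued
with opposite orientations and offset `d`. The tag, at position `0`, stays. -/
def reflect {d : ℕ} (hd : d < L) (i : Fin (L + 1)) : Fin (L + 1) :=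
  ⟨if i.val = 0 then 0 else if i.val ≤ d then d + 1 - i.val else L + d + 1 - i.val, by
    split_ifs <;> omega⟩

theorem val_reflect {d : ℕ} (hd : d < L) (i : Fin (L + 1)) : (reflect hd i).val =
    if i.val = 0 then 0 else if i.val ≤ d then d + 1 - i.val else L + d + 1 - i.val := rfl

theorem reflect_reflect {d : ℕ} (hd : d < L) (i : Fin (L + 1)) :
    reflect hd (reflect hd i) = i := by
  ext
  have := i.2
  simp only [val_reflect]
  split_ifs <;> omega

theorem reflect_eq_zero_iff {d : ℕ} (hd : d < L) (i : Fin (L + 1)) : reflect hd i = 0 ↔ i = 0 := by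
  have := i.2
  simp only [Fin.ext_iff, val_reflect, Fin.val_zero]
  split_ifs <;> omega

/-- The alternatives spell out a congruence modulo `L` between positions of opposite letters,
numbered from zero. -/
theorem exists_reflect_succ {d : ℕ} (hd : d < L) (i : Fin L) :
    ∃ i' : Fin L, reflect hd i.succ = i'.succ ∧
      (i.val + i'.val + 1 = d ∨ i.val + i'.val + 1 = L + d) := by
  obtain ⟨i', hi'⟩ := Fin.exists_succ_eq_of_ne_zero
    (mt (reflect_eq_zero_iff hd i.succ).1 (Fin.succ_ne_zero i))
  refine ⟨i', hi'.symm, ?_⟩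
  have e := congrArg Fin.val hi'
  have := i.2
  have := i'.2
  rw [val_reflect, Fin.val_succ, Fin.val_succ] at e
  split_ifs at e <;> omega

/-- The two loops are the boundary components of an annulus whose tags are `d` apart. -/
def TaggedLoop.IsAnnular (d : ℕ) (s t : TaggedLoop k L) : Prop :=
  ∀ i i' : Fin L, (i.val + i'.val + 1 = d ∨ i.val + i'.val + 1 = L + d) →
    t.word i' = (s.word i).inv

theorem TaggedLoop.IsAnnular.symm {d : ℕ} {s t : TaggedLoop k L} (h : s.IsAnnular d t) :
    t.IsAnnular d s := by
  intro i i' hi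
  rw [Letter.eq_inv_comm]
  exact h i' i (by omega)

/-- The involution that pairs the letters of the boundary components of an annulus. -/
def annulusOpp {d : ℕ} (hd : d < L) (h : Bool × Fin (L + 1)) : Bool × Fin (L + 1) :=
  (if h.2 = 0 then h.1 else !h.1, reflect hd h.2)

theorem annulusOpp_annulusOpp {d : ℕ} (hd : d < L) (h : Bool × Fin (L + 1)) :
    annulusOpp hd (annulusOpp hd h) = h := by
  obtain ⟨b, i⟩ := h
  simp only [annulusOpp, reflect_reflect, reflect_eq_zero_iff]
  split_ifs <;> simp

/-- The number of the vertex of a half-edge of the annulus. -/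
def annulusVal (L d : ℕ) (b : Bool) (i : ℕ) : ℕ :=
  if b = true then if i = 0 then d else if i ≤ d + 1 then d + 1 - i else L + d + 1 - i
  -- Truncated subtraction puts the tag (position `0`) and the first letter (position `1`) on the
  -- same vertex `0`.
  else i - 1

/-- The vertex of a half-edge of the annulus. -/
def annulusVert {d : ℕ} (hd : d < L) (h : Bool × Fin (L + 1)) : Fin L :=
  ⟨annulusVal L d h.1 h.2.val, by
    have := h.2.2
    unfold annulusVal
    split_ifs <;> omega⟩

/-- The annulus bounded by two tagged loops. -/
def annulus {d : ℕ} (hd0 : 0 < d) (hd : d < L) (s t : TaggedLoop k L) (h : s.IsAnnular d t) :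
    Gluing k L where
  L_pos := by omega
  J := Bool
  finite_J := inferInstance
  loop b := if b then t else s
  opp := ⟨annulusOpp hd, annulusOpp hd, annulusOpp_annulusOpp hd, annulusOpp_annulusOpp hd⟩
  opp_opp := annulusOpp_annulusOpp hd
  opp_eq_iff := by
    rintro ⟨b, i⟩
    constructor
    · intro e
      have e1 := congrArg Prod.fst e
      by_contra h0
      simp [annulusOpp, show i ≠ 0 from h0] at e1
    · intro e
      obtain rfl : i = 0 := e
      change annulusOpp hd (b, 0) = (b, 0)
      rw [annulusOpp, (reflect_eq_zero_iff hd _).2 rfl, if_pos rfl]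
  label_opp := by
    intro b i
    obtain ⟨i', hi', hii⟩ := exists_reflect_succ hd i
    simp only [Equiv.coe_fn_mk, annulusOpp, hi', Fin.succ_ne_zero, if_false,
      TaggedLoop.labelAt_succ]
    cases b
    · exact h i i' hii
    · exact h.symm i i' hii
  V := Fin L
  vert := annulusVert hd
  vert_surjective v := ⟨(false, v.succ), by ext; simp [annulusVert, annulusVal]⟩
  vert_rotate := by
    intro b i
    have := i.2
    ext
    simp only [annulusVert, annulusOpp, Equiv.coe_fn_mk, val_finRotate, Fin.ext_iff, Fin.val_zero,
      val_reflect]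
    cases b <;> grind [annulusVal]
  consecutive := by
    rintro ⟨b, i⟩ ⟨b', i'⟩ e
    have := i.2
    have := i'.2
    have e := congrArg Fin.val e
    simp only [annulusVert, annulusOpp, Equiv.coe_fn_mk, val_finRotate, Fin.ext_iff, Fin.val_zero,
      Prod.ext_iff, val_reflect] at e ⊢
    cases b <;> cases b' <;> grind [annulusVal]

theorem annulus_isAnnulus {d : ℕ} (hd0 : 0 < d) (hd : d < L) (s t : TaggedLoop k L)
    (h : s.IsAnnular d t) : (annulus hd0 hd s t h).fatgraph.IsAnnulus := by
  set G := annulus hd0 hd s t h with hG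
  refine ⟨?_, ?_, ?_⟩
  · have : Nonempty G.J := ⟨false⟩
    refine G.fatgraph_connected fun j j' => ?_
    by_cases e : j = j'
    · rw [e]
    · refine Relation.ReflTransGen.single ⟨Fin.last L, ?_⟩
      have key : ∀ b b' : Bool, b ≠ b' → (if Fin.last L = 0 then b else !b) = b' := by
        have h0 : Fin.last L ≠ 0 := by simp [Fin.ext_iff]; omega
        simp only [h0, if_false]
        decide
      exact key j j' e
  · rw [G.fatgraph_numBoundary]
    change Nat.card Bool = 2
    simp
  · rw [G.fatgraph_eulerChar]
    change (Nat.card (Fin L) : ℤ) - (Nat.card Bool * L / 2 : ℕ) = 0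
    simp

/-- The distance to vertex `0` on a cycle of length `L` is `min v (L - v)`. It changes by at most
one along an edge and is at least `L / 4` at `d`, for offsets between `L / 4` and `3L / 4`. -/
theorem annulus_tag_dist {d : ℕ} (hd0 : 0 < d) (hd : d < L) (s t : TaggedLoop k L)
    (h : s.IsAnnular d t) (h1 : L ≤ 4 * d) (h2 : 4 * d ≤ 3 * L) (u v : Fin L) (huv : u ≠ v)
    (hu : u.val = 0 ∨ u.val = d) (hv : v.val = 0 ∨ v.val = d) :
    (L : ℕ∞) ≤ 4 * (annulus hd0 hd s t h).fatgraph.graph.edist u v := by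
  refine TaggedFatgraph.le_edist_of_lipschitz (annulus hd0 hd s t h).fatgraph
    (fun v : Fin L => min (v.val : ℤ) (L - v.val)) ?_ u v ?_
  · rintro ⟨b, i⟩
    change |min ((annulusVert hd (annulusOpp hd (b, i))).val : ℤ)
      (L - (annulusVert hd (annulusOpp hd (b, i))).val) - min ((annulusVert hd (b, i)).val : ℤ)
      (L - (annulusVert hd (b, i)).val)| ≤ 1
    have := i.2
    simp only [annulusOpp, annulusVert, val_reflect, Fin.ext_iff, Fin.val_zero, abs_le]
    cases b <;> grind [annulusVal]
  · have : u.val ≠ v.val := fun e => huv (Fin.ext e)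
    change (L : ℤ) ≤ 4 * |min (u.val : ℤ) (L - u.val) - min (v.val : ℤ) (L - v.val)|
    rcases abs_cases (min (u.val : ℤ) (L - u.val) - min (v.val : ℤ) (L - v.val)) with ⟨e, _⟩ | ⟨e, _⟩
      <;> rw [e] <;> omega

theorem annulus_isGoodAnnulus {d : ℕ} (hd0 : 0 < d) (hd : d < L) (s t : TaggedLoop k L)
    (h : s.IsAnnular d t) (h1 : L ≤ 4 * d) (h2 : 4 * d ≤ 3 * L) :
    (annulus hd0 hd s t h).fatgraph.IsGoodAnnulus L := by
  refine ⟨annulus_isAnnulus hd0 hd s t h, Gluing.fatgraph_boundaryIn _, ?_⟩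
  rintro ⟨b, i⟩ ⟨b', i'⟩ hne hi hi'
  obtain rfl : i = 0 := (Gluing.fatgraph_isTag _ _).1 hi
  obtain rfl : i' = 0 := (Gluing.fatgraph_isTag _ _).1 hi'
  have hb : ∀ b : Bool, (annulusVert hd (b, 0)).val = 0 ∨ (annulusVert hd (b, 0)).val = d := by
    rintro (_ | _) <;> simp [annulusVert, annulusVal]
  refine annulus_tag_dist hd0 hd s t h h1 h2 _ _ ?_ (hb b) (hb b')
  intro e
  apply hne
  change annulusVert hd ((b : Bool), 0) = annulusVert hd ((b' : Bool), 0) at e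
  have key : ∀ b b' : Bool, annulusVert hd (b, 0) = annulusVert hd (b', 0) → b = b' := by
    rintro (_ | _) (_ | _) e <;> simp [annulusVert, annulusVal, Fin.ext_iff] at e ⊢ <;> omega
  exact Prod.ext (key b b' e) rfl

/-- Only the two tagged vertices `0` and `d` can have valence three; elsewhere `next` is an
involution. -/
theorem annulus_isThin {d : ℕ} (hd0 : 0 < d) (hd : d < L) (s t : TaggedLoop k L)
    (h : s.IsAnnular d t) (h1 : L ≤ 4 * d) (h2 : 4 * d ≤ 3 * L) :
    (annulus hd0 hd s t h).fatgraph.IsThin L := by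
  have key : ∀ v : Fin L, (annulus hd0 hd s t h).fatgraph.valence v = 3 →
      v.val = 0 ∨ v.val = d := by
    intro v hv
    by_contra hv0
    push Not at hv0
    have hvL := v.2
    have e := (Gluing.fatgraph_consecutive _).valence_eq_two
      (Gluing.fatgraph_next_ne (annulus hd0 hd s t h) (false, v.succ)) ?_
    · have hvv : (annulus hd0 hd s t h).fatgraph.vert (false, v.succ) = v := by
        apply Fin.ext; change v.succ.val - 1 = v.val; simp
      rw [hvv, hv] at e
      omega
    · rw [Gluing.fatgraph_next, Gluing.fatgraph_next]
      change ((annulusOpp hd ((annulusOpp hd (false, v.succ)).1,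
        finRotate (L + 1) (annulusOpp hd (false, v.succ)).2)).1, finRotate (L + 1)
        (annulusOpp hd ((annulusOpp hd (false, v.succ)).1,
        finRotate (L + 1) (annulusOpp hd (false, v.succ)).2)).2) = (false, v.succ)
      simp only [annulusOpp, val_finRotate, Fin.ext_iff, Fin.val_zero,
        Prod.ext_iff, val_reflect, Fin.val_succ]
      grind
  refine ⟨Gluing.fatgraph_boundaryIn _, Gluing.fatgraph_isTrivalent _, ?_⟩
  intro u v huv hu hv
  exact annulus_tag_dist hd0 hd s t h h1 h2 u v huv (key u hu) (key v hv)

theorem annulus_boundary {d : ℕ} (hd0 : 0 < d) (hd : d < L) (s t : TaggedLoop k L)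
    (h : s.IsAnnular d t) :
    (annulus hd0 hd s t h).fatgraph.boundary L = Pi.single s 1 + Pi.single t 1 := by
  let : Fintype (annulus hd0 hd s t h).J := inferInstanceAs (Fintype Bool)
  rw [Gluing.fatgraph_boundary]
  change ∑ b : Bool, (Pi.single (if b then t else s) 1 : LoopSpace k L) = _
  rw [Fintype.sum_bool, add_comm]
  simp

end GoodPants

/-! ### Construction of good pairs of pants. -/

namespace GoodPants

variable {k L : ℕ}

/-- Three tagged loops of length `4 * q` are the boundary components of a good pair of pants. -/
def IsPantsTriple (q : ℕ) (s : Fin 3 → TaggedLoop k L) : Prop :=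
  ∀ j, ∀ i i' : Fin L, q ≤ i.val → i.val < 3 * q →
    (i.val + i'.val + 1 = 2 * q ∨ i.val + i'.val + 1 = L + 2 * q) →
    (s (finRotate 3 j)).word i' = ((s j).word i).inv

/-- The three edges of the pants form strands from one branch vertex to the other; the loop `j`
runs from the middle of strand `j` to its end, back along the next strand, and on along strand `j`
to its middle. This is the strand of position `i` of the loop `j`. -/
def pantsStrand (q j i : ℕ) : ℕ :=
  if q < i ∧ i ≤ 3 * q then if j = 2 then 0 else j + 1 else j

/-- The position along its strand of the vertex of the half-edge `i` of a boundary loop. -/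
def pantsPos (q i : ℕ) : ℕ :=
  if i = 0 then q else if i ≤ q then q + i - 1 else if i ≤ 3 * q then 3 * q + 1 - i
  else i - 3 * q - 1

/-- The number of the vertex at position `p` of strand `e`. -/
def pantsCode (q e p : ℕ) : ℕ :=
  -- The two branch vertices are `0` and `1`. The interior vertices, `2q - 1` on each of three
  -- strands, are numbered from `2` on, for `6q - 1` vertices in all.
  if p = 0 then 0 else if p = 2 * q then 1 else 3 * p + e - 1

theorem pantsCode_lt {q e p : ℕ} (hq : 0 < q) (he : e < 3) (hp : p ≤ 2 * q) :
    pantsCode q e p < 6 * q - 1 := by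
  unfold pantsCode; split_ifs <;> omega

theorem pantsCode_eq_iff {q e p e' p' : ℕ} (he : e < 3) (he' : e' < 3) :
    pantsCode q e p = pantsCode q e' p' ↔ p = p' ∧ (e = e' ∨ p = 0 ∨ p = 2 * q) := by
  unfold pantsCode; grind

theorem pantsStrand_lt {q j : ℕ} (i : ℕ) (hj : j < 3) : pantsStrand q j i < 3 := by
  unfold pantsStrand; split_ifs <;> omega

theorem pantsPos_le {q i : ℕ} (hi : i ≤ 4 * q) : pantsPos q i ≤ 2 * q := by
  unfold pantsPos; split_ifs <;> omega

/-- The component of the opposite half-edge. -/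
def pantsTurn (q : ℕ) (j : Fin 3) (i : ℕ) : Fin 3 :=
  ⟨if i = 0 then j else if q < i ∧ i ≤ 3 * q then if j.val = 2 then 0 else j + 1
    else if j.val = 0 then 2 else j - 1, by have := j.2; split_ifs <;> omega⟩

section

variable {q : ℕ}

/-- The involution that pairs the letters of the boundary components of a pair of pants. -/
def pantsOpp (hd : 2 * q < L) (h : Fin 3 × Fin (L + 1)) : Fin 3 × Fin (L + 1) :=
  (pantsTurn q h.1 h.2, reflect hd h.2)

theorem pantsOpp_pantsOpp (hL : L = 4 * q) (hd : 2 * q < L) (h : Fin 3 × Fin (L + 1)) :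
    pantsOpp hd (pantsOpp hd h) = h := by
  obtain ⟨j, i⟩ := h
  have := i.2
  have := j.2
  simp only [pantsOpp, reflect_reflect, pantsTurn, val_reflect, Prod.ext_iff, Fin.ext_iff, and_true]
  grind

/-- The vertex of a half-edge of the pants. -/
def pantsVert (hq : 0 < q) (hL : L = 4 * q) (h : Fin 3 × Fin (L + 1)) : Fin (6 * q - 1) :=
  ⟨pantsCode q (pantsStrand q h.1 h.2) (pantsPos q h.2),
    pantsCode_lt hq (pantsStrand_lt _ h.1.2) (pantsPos_le (by omega))⟩

theorem pantsVert_eq_iff (hq : 0 < q) (hL : L = 4 * q) (h h' : Fin 3 × Fin (L + 1)) :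
    pantsVert hq hL h = pantsVert hq hL h' ↔ pantsPos q h.2 = pantsPos q h'.2 ∧
      (pantsStrand q h.1 h.2 = pantsStrand q h'.1 h'.2 ∨ pantsPos q h.2 = 0 ∨
        pantsPos q h.2 = 2 * q) := by
  rw [Fin.ext_iff]
  exact pantsCode_eq_iff (pantsStrand_lt _ h.1.2) (pantsStrand_lt _ h'.1.2)

theorem pants_cases (hL : L = 4 * q) (i : Fin (L + 1)) : i.val = 0 ∨ (0 < i.val ∧ i.val ≤ q) ∨
    (q < i.val ∧ i.val ≤ 2 * q) ∨ (2 * q < i.val ∧ i.val ≤ 3 * q) ∨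
      (3 * q < i.val ∧ i.val ≤ 4 * q) := by
  have := i.2
  omega

/-- The pair of pants bounded by three tagged loops. -/
def pants (hq : 0 < q) (hL : L = 4 * q) (s : Fin 3 → TaggedLoop k L) (hs : IsPantsTriple q s) : Gluing k L where
  L_pos := by omega
  J := Fin 3
  finite_J := inferInstance
  loop := s
  opp := ⟨pantsOpp (by omega), pantsOpp (by omega), pantsOpp_pantsOpp hL _, pantsOpp_pantsOpp hL _⟩
  opp_opp := pantsOpp_pantsOpp hL _
  opp_eq_iff := by
    rintro ⟨j, i⟩
    have := i.2
    have := j.2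
    simp only [Equiv.coe_fn_mk, pantsOpp, pantsTurn, val_reflect, Prod.ext_iff, Fin.ext_iff,
      Fin.val_zero]
    grind
  label_opp := by
    have hd : 2 * q < L := by omega
    have key : ∀ j, ∀ i : Fin L, q ≤ i.val → i.val < 3 * q →
        (s (pantsOpp hd (j, i.succ)).1).labelAt (pantsOpp hd (j, i.succ)).2 =
          ((s j).word i).inv := by
      intro j i h1 h2
      obtain ⟨i', hi', hii⟩ := exists_reflect_succ hd i
      have e : pantsTurn q j i.succ = finRotate 3 j := by
        ext
        simp only [pantsTurn, val_finRotate, Fin.val_succ]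
        grind
      simp only [pantsOpp, hi', TaggedLoop.labelAt_succ, e]
      exact hs j i i' h1 h2 hii
    intro j i
    by_cases h : q ≤ i.val ∧ i.val < 3 * q
    · exact key j i h.1 h.2
    -- `IsPantsTriple` speaks only of the letters of a loop on the neighbouring strand. Letters on
    -- its own strand are opposite to such letters, so their condition is the inverted one.
    · obtain ⟨i', hi', hii⟩ := exists_reflect_succ hd i
      have e := pantsOpp_pantsOpp hL hd (j, i.succ)
      have h2 : (pantsOpp hd (j, i.succ)) = ((pantsOpp hd (j, i.succ)).1, i'.succ) := by
        rw [← hi']; rfl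
      have := i.2
      have := i'.2
      have h3 := key (pantsOpp hd (j, i.succ)).1 i' (by omega) (by omega)
      rw [← h2, e] at h3
      simp only [TaggedLoop.labelAt_succ] at h3
      simp only [Equiv.coe_fn_mk]
      rw [h2, TaggedLoop.labelAt_succ, Letter.eq_inv_comm]
      exact h3
  V := Fin (6 * q - 1)
  vert := pantsVert hq hL
  vert_surjective v := by
    have := v.2
    by_cases h0 : v.val = 0
    · refine ⟨(0, ⟨3 * q + 1, by omega⟩), ?_⟩
      ext
      simp only [pantsVert, pantsCode, pantsPos, pantsStrand]
      grind
    by_cases h1 : v.val = 1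
    · refine ⟨(0, ⟨q + 1, by omega⟩), ?_⟩
      ext
      simp only [pantsVert, pantsCode, pantsPos, pantsStrand]
      grind
    · obtain ⟨p, e, he, hv⟩ : ∃ p e, e < 3 ∧ v.val + 1 = 3 * p + e :=
        ⟨(v.val + 1) / 3, (v.val + 1) % 3, Nat.mod_lt _ (by omega), by omega⟩
      by_cases h2 : p < q
      · refine ⟨(⟨e, he⟩, ⟨3 * q + 1 + p, by omega⟩), ?_⟩
        ext
        simp only [pantsVert, pantsCode, pantsPos, pantsStrand]
        split_ifs <;> omega
      · obtain ⟨c, rfl⟩ := Nat.exists_eq_add_of_le (not_lt.1 h2)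
        refine ⟨(⟨e, he⟩, ⟨c + 1, by omega⟩), ?_⟩
        ext
        simp only [pantsVert, pantsCode, pantsPos, pantsStrand]
        grind
  vert_rotate := by
    intro j i
    have := i.2
    have := j.2
    rw [pantsVert_eq_iff]
    simp only [Equiv.coe_fn_mk, pantsOpp, val_reflect, val_finRotate, pantsTurn]
    rcases pants_cases hL i with h | h | h | h | h <;>
      grind (splits := 30) [pantsPos, pantsStrand]
  consecutive := by
    rintro ⟨j, i⟩ ⟨j', i'⟩ e
    have := j.2
    have := j'.2
    rw [pantsVert_eq_iff] at e
    simp only [Equiv.coe_fn_mk, pantsOpp, val_reflect, val_finRotate, pantsTurn, Prod.ext_iff,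
      Fin.ext_iff] at e ⊢
    rcases pants_cases hL i with h | h | h | h | h <;>
    rcases pants_cases hL i' with h' | h' | h' | h' | h' <;>
    grind (splits := 30) [pantsPos, pantsStrand]

end
end GoodPants

/-! ### Branch vertices, edges and distances in a pair of pants. -/

namespace GoodPants

variable {k L q : ℕ} (hq : 0 < q) (hL : L = 4 * q) (s : Fin 3 → TaggedLoop k L)
  (hs : IsPantsTriple q s)

theorem pants_next (h : Fin 3 × Fin (L + 1)) :
    (pants hq hL s hs).fatgraph.next h =
      (pantsTurn q h.1 h.2, finRotate (L + 1) (reflect (by omega : 2 * q < L) h.2)) := rfl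

theorem val_pantsTurn (j : Fin 3) (i : ℕ) : (pantsTurn q j i).val =
    if i = 0 then j.val else if q < i ∧ i ≤ 3 * q then if j.val = 2 then 0 else j.val + 1
    else if j.val = 0 then 2 else j.val - 1 := rfl

theorem pants_next_next_of_pos (h : Fin 3 × Fin (L + 1)) (h0 : pantsPos q h.2 ≠ 0)
    (h1 : pantsPos q h.2 ≠ q) (h2 : pantsPos q h.2 ≠ 2 * q) :
    (pants hq hL s hs).fatgraph.next ((pants hq hL s hs).fatgraph.next h) = h := by
  refine (pants_next hq hL s hs _).trans ?_
  rw [pants_next]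
  obtain ⟨j, i⟩ := h
  have hj := j.2
  have hd : 2 * q < L := by omega
  have e1 := val_reflect hd i
  have e2 := val_finRotate (reflect hd i)
  have e3 := val_reflect hd (finRotate (L + 1) (reflect hd i))
  have e4 := val_finRotate (reflect hd (finRotate (L + 1) (reflect hd i)))
  have e5 := val_pantsTurn (q := q) j i
  have e6 := val_pantsTurn (q := q) (pantsTurn q j i) (finRotate (L + 1) (reflect hd i))
  unfold pantsPos at h0 h1 h2
  refine Prod.ext (Fin.ext ?_) (Fin.ext ?_) <;> dsimp only at * <;>
  rcases pants_cases hL i with h | h | h | h | h <;> grind (splits := 30)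

theorem pants_next_next_ne (h : Fin 3 × Fin (L + 1))
    (h0 : pantsPos q h.2 = 0 ∨ pantsPos q h.2 = 2 * q) :
    (pants hq hL s hs).fatgraph.next ((pants hq hL s hs).fatgraph.next h) ≠ h := by
  refine fun e => absurd ((pants_next hq hL s hs _).symm.trans e) ?_
  rw [pants_next]
  obtain ⟨j, i⟩ := h
  have hj := j.2
  have hd : 2 * q < L := by omega
  have e1 := val_reflect hd i
  have e2 := val_finRotate (reflect hd i)
  have e5 := val_pantsTurn (q := q) j i
  have e6 := val_pantsTurn (q := q) (pantsTurn q j i) (finRotate (L + 1) (reflect hd i))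
  intro e
  have e := congrArg (fun x : Fin 3 × Fin (L + 1) => x.1.val) e
  unfold pantsPos at h0
  dsimp only at *
  rcases pants_cases hL i with h | h | h | h | h <;> grind (splits := 30)

theorem Gluing.valence_eq_two (G : Gluing k L) (h : G.J × Fin (L + 1))
    (hn : G.fatgraph.next (G.fatgraph.next h) = h) : G.fatgraph.valence (G.vert h) = 2 :=
  G.fatgraph_consecutive.valence_eq_two (G.fatgraph_next_ne h) hn

theorem _root_.GoodPants.Gluing.valence_eq_three (G : Gluing k L) (h : G.J × Fin (L + 1))
    (hn : G.fatgraph.next (G.fatgraph.next h) ≠ h) : G.fatgraph.valence (G.vert h) = 3 :=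
  G.fatgraph_consecutive.valence_eq_three (G.fatgraph_next_ne h) hn

theorem pants_valence_eq_three {h : Fin 3 × Fin (L + 1)}
    (hv : (pants hq hL s hs).fatgraph.valence (pantsVert hq hL h) = 3) :
    pantsPos q h.2 = 0 ∨ pantsPos q h.2 = q ∨ pantsPos q h.2 = 2 * q := by
  by_contra hcon
  push Not at hcon
  have e := (pants hq hL s hs).valence_eq_two h
    (pants_next_next_of_pos hq hL s hs h hcon.1 hcon.2.1 hcon.2.2)
  have := hv.symm.trans e
  omega

theorem pants_hasTag_iff (h : Fin 3 × Fin (L + 1)) :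
    (pants hq hL s hs).fatgraph.HasTag (pantsVert hq hL h) ↔ pantsPos q h.2 = q := by
  constructor
  · rintro ⟨⟨j, i⟩, e, ht⟩
    obtain rfl : i = 0 := (Gluing.fatgraph_isTag _ _).1 ht
    have e : pantsVert hq hL (j, 0) = pantsVert hq hL h := e
    rw [pantsVert_eq_iff] at e
    rw [← e.1]
    simp [pantsPos]
  · intro e
    refine ⟨((⟨pantsStrand q h.1 h.2, pantsStrand_lt _ h.1.2⟩, 0) : Fin 3 × Fin (L + 1)), ?_,
      (Gluing.fatgraph_isTag _ _).2 rfl⟩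
    change pantsVert hq hL _ = pantsVert hq hL h
    rw [pantsVert_eq_iff]
    refine ⟨?_, Or.inl ?_⟩
    · rw [e]; simp [pantsPos]
    · simp [pantsStrand]

theorem pants_isBranch_iff (h : Fin 3 × Fin (L + 1)) :
    (pants hq hL s hs).fatgraph.IsBranch (pantsVert hq hL h) ↔
      pantsPos q h.2 = 0 ∨ pantsPos q h.2 = 2 * q := by
  refine (and_congr_right fun _ => not_congr (pants_hasTag_iff hq hL s hs h)).trans ?_
  constructor
  · rintro ⟨h1, h2⟩
    have := pants_valence_eq_three hq hL s hs h1
    omega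
  · intro h0
    exact ⟨(pants hq hL s hs).valence_eq_three h (pants_next_next_ne hq hL s hs h h0), by omega⟩

theorem pants_isPants : (pants hq hL s hs).fatgraph.IsPants := by
  refine ⟨?_, ?_, ?_⟩
  · have : Nonempty (pants hq hL s hs).J := ⟨(0 : Fin 3)⟩
    refine Gluing.fatgraph_connected _ ?_
    have step : ∀ j : Fin 3, ∃ i, ((pants hq hL s hs).opp (j, i)).1 = finRotate 3 j := by
      intro j
      refine ⟨⟨q + 1, by omega⟩, ?_⟩
      apply Fin.ext
      change (pantsTurn q j (q + 1)).val = _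
      have := j.2
      simp only [pantsTurn, val_finRotate]
      grind
    have key : ∀ j j' : Fin 3, j' = j ∨ j' = finRotate 3 j ∨ j' = finRotate 3 (finRotate 3 j) := by
      decide
    intro j j'
    rcases key j j' with e | e | e
    · rw [e]
    · exact Relation.ReflTransGen.single (by rw [e]; exact step j)
    · exact (Relation.ReflTransGen.single (step j)).tail (by rw [e]; exact step _)
  · rw [Gluing.fatgraph_numBoundary]
    change Nat.card (Fin 3) = 3
    simp
  · rw [Gluing.fatgraph_eulerChar]
    change (Nat.card (Fin (6 * q - 1)) : ℤ) - (Nat.card (Fin 3) * L / 2 : ℕ) = -1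
    simp only [Nat.card_eq_fintype_card, Fintype.card_fin]
    omega

/-- Away from the branch vertices a strand has a single way forward, which is the next letter of the
boundary loop. The tag at position `0` is skipped, so position `L` is followed by `1`. -/
theorem pants_step (hd : 2 * q < L) {h h' : Fin 3 × Fin (L + 1)} (h1 : h.2.val ≠ 0)
    (h1' : h'.2.val ≠ 0) (h2 : ¬ (pantsPos q h.2 = 0 ∨ pantsPos q h.2 = 2 * q))
    (h3 : pantsVert hq hL h = pantsVert hq hL (pantsOpp hd h')) (h4 : h ≠ pantsOpp hd h') :
    h.2.val = if h'.2.val = L then 1 else h'.2.val + 1 := by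
  obtain ⟨a, i⟩ := h
  obtain ⟨b, i'⟩ := h'
  have ha := a.2
  have hb := b.2
  rw [pantsVert_eq_iff] at h3
  have e1 := val_reflect hd i'
  have e2 := val_pantsTurn (q := q) b i'
  have h4 : ¬ (a.val = (pantsTurn q b i').val ∧ i.val = (reflect hd i').val) :=
    fun e => h4 (Prod.ext (Fin.ext e.1) (Fin.ext e.2))
  simp only [pantsOpp] at h3
  dsimp only at *
  simp only [pantsPos, pantsStrand] at h2 h3
  rcases pants_cases hL i with h | h | h | h | h <;>
  rcases pants_cases hL i' with h' | h' | h' | h' | h' <;>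
  grind (splits := 30)

/-- Edges leave a branch vertex at position `q + 1` or `3q + 1` of a boundary loop and reach the
next one through position `3q` or `q`, respectively, after `2q` steps. The second kind wraps around
past the tag. -/
theorem pants_path {P : ℕ → ℕ} {m : ℕ} (hq : 0 < q) (hm : 0 < m)
    (start : P 0 = q + 1 ∨ P 0 = 3 * q + 1)
    (move : ∀ j, j + 1 < m → P (j + 1) = if P j = 4 * q then 1 else P j + 1)
    (mid : ∀ j, j + 1 < m → P (j + 1) ≠ q + 1 ∧ P (j + 1) ≠ 3 * q + 1)
    (close : P (m - 1) = q ∨ P (m - 1) = 3 * q) :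
    m = 2 * q ∧ ∀ j, 0 < j → j < m → (pantsPos q (P j) = q ↔ j = q) := by
  rcases start with h0 | h0
  · have key : ∀ j < m, P j = q + 1 + j ∧ j < 2 * q := by
      intro j
      induction j with
      | zero => intro _; omega
      | succ j ih =>
        intro hj
        have h1 := ih (by omega)
        have h2 := move j hj
        have h3 := mid j hj
        rw [if_neg (by omega)] at h2
        omega
    have h1 := key (m - 1) (by omega)
    refine ⟨by omega, fun j hj0 hj => ?_⟩
    have h2 := key j hj
    unfold pantsPos
    split_ifs <;> omega
  · have key : ∀ j < m, (j < q ∧ P j = 3 * q + 1 + j) ∨ (q ≤ j ∧ P j = j - q + 1 ∧ j < 2 * q) := by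
      intro j
      induction j with
      | zero => intro _; omega
      | succ j ih =>
        intro hj
        have h1 := ih (by omega)
        have h2 := move j hj
        have h3 := mid j hj
        split_ifs at h2 <;> omega
    have h1 := key (m - 1) (by omega)
    refine ⟨by omega, fun j hj0 hj => ?_⟩
    have h2 := key j hj
    unfold pantsPos
    split_ifs <;> omega

theorem pants_isEdge {p : ℕ → Fin 3 × Fin (L + 1)} {m : ℕ}
    (hp : (pants hq hL s hs).fatgraph.IsEdge p m) :
    2 * m = L ∧ ∀ j, 0 < j → j < m → (pantsPos q (p j).2 = q ↔ 4 * j = L) := by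
  obtain ⟨hm, htag, hb0, hb1, hmid⟩ := hp
  have hb0 : (pants hq hL s hs).fatgraph.IsBranch (pantsVert hq hL (p 0)) := hb0
  rw [pants_isBranch_iff] at hb0
  have hd : 2 * q < L := by omega
  have htag : ∀ j < m, (p j).2.val ≠ 0 := fun j hj e =>
    htag j hj ((Gluing.fatgraph_isTag _ _).2 (Fin.ext e))
  have hb1 : (pants hq hL s hs).fatgraph.IsBranch
      (pantsVert hq hL (pantsOpp hd (p (m - 1)))) := hb1
  rw [pants_isBranch_iff] at hb1
  have hstep : ∀ j, j + 1 < m → ¬ (pantsPos q (p (j + 1)).2 = 0 ∨ pantsPos q (p (j + 1)).2 = 2 * q)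
      ∧ pantsVert hq hL (p (j + 1)) = pantsVert hq hL (pantsOpp hd (p j)) ∧
      p (j + 1) ≠ pantsOpp hd (p j) := by
    intro j hj
    obtain ⟨h1, h2, h3⟩ := hmid j hj
    have h1 : ¬ (pants hq hL s hs).fatgraph.IsBranch (pantsVert hq hL (p (j + 1))) := h1
    rw [pants_isBranch_iff] at h1
    exact ⟨h1, h2, h3⟩
  have start : (p 0).2.val = q + 1 ∨ (p 0).2.val = 3 * q + 1 := by
    have := htag 0 hm
    rcases pants_cases hL (p 0).2 with h | h | h | h | h <;> grind [pantsPos]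
  have move : ∀ j, j + 1 < m → (p (j + 1)).2.val = if (p j).2.val = L then 1 else
      (p j).2.val + 1 := by
    intro j hj
    obtain ⟨h1, h2, h3⟩ := hstep j hj
    have t1 := htag j (by omega)
    have t2 := htag (j + 1) hj
    exact pants_step hq hL hd t2 t1 h1 h2 h3
  have close : pantsPos q (pantsOpp hd (p (m - 1))).2 = 0 ∨
    pantsPos q (pantsOpp hd (p (m - 1))).2 = 2 * q → (p (m - 1)).2.val = q ∨
      (p (m - 1)).2.val = 3 * q := by
    have := htag (m - 1) (by omega)
    generalize p (m - 1) = b at *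
    simp only [pantsOpp, val_reflect]
    rcases pants_cases hL b.2 with h | h | h | h | h <;> grind [pantsPos]
  have close := close hb1
  have hpos : ∀ j, j + 1 < m → (p (j + 1)).2.val ≠ q + 1 ∧ (p (j + 1)).2.val ≠ 3 * q + 1 := by
    intro j hj
    have h1 := (hstep j hj).1
    constructor <;> intro e <;> rw [e] at h1 <;> clear * - h1 hq <;> grind [pantsPos]
  obtain ⟨h1, h2⟩ := pants_path (P := fun j => (p j).2.val) hq hm start
    (fun j hj => by rw [← hL]; exact move j hj) hpos close
  exact ⟨by omega, fun j hj0 hj => (h2 j hj0 hj).trans (by omega)⟩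

theorem pants_isGoodPants : (pants hq hL s hs).fatgraph.IsGoodPants L := by
  refine ⟨pants_isPants hq hL s hs, Gluing.fatgraph_boundaryIn _, Gluing.fatgraph_isTrivalent _, ?_⟩
  intro p m hp
  obtain ⟨h1, h2⟩ := pants_isEdge hq hL s hs hp
  exact ⟨h1, fun j hj0 hj => (pants_hasTag_iff hq hL s hs (p j)).trans (h2 j hj0 hj)⟩

include hL in
theorem pants_opp_strand (hd : 2 * q < L) (h : Fin 3 × Fin (L + 1)) :
    pantsStrand q (pantsOpp hd h).1 (pantsOpp hd h).2 = pantsStrand q h.1 h.2 := by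
  obtain ⟨j, i⟩ := h
  have hj := j.2
  have e1 := val_reflect hd i
  have e2 := val_pantsTurn (q := q) j i
  simp only [pantsOpp, pantsStrand]
  rcases pants_cases hL i with h | h | h | h | h <;> grind (splits := 30)

include hL in
theorem pants_opp_pos (hd : 2 * q < L) (h : Fin 3 × Fin (L + 1)) :
    pantsPos q (pantsOpp hd h).2 ≤ pantsPos q h.2 + 1 ∧
      pantsPos q h.2 ≤ pantsPos q (pantsOpp hd h).2 + 1 := by
  obtain ⟨j, i⟩ := h
  have e1 := val_reflect hd i
  simp only [pantsOpp, pantsPos]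
  rcases pants_cases hL i with h | h | h | h | h <;> grind (splits := 30)

theorem pantsCode_div {q e p : ℕ} (he : e < 3) :
    (if pantsCode q e p = 0 then 0 else if pantsCode q e p = 1 then 2 * q
      else (pantsCode q e p + 1) / 3) = p := by
  unfold pantsCode
  grind

theorem pantsCode_mod {q e p : ℕ} (he : e < 3) (h0 : p ≠ 0) (h1 : p ≠ 2 * q) :
    (pantsCode q e p + 1) % 3 = e ∧ 2 ≤ pantsCode q e p := by
  rw [pantsCode, if_neg h0, if_neg h1]
  omega

/-- A function of strand and position that is constant on the two branch vertices is a function on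
the vertices. -/
theorem pants_exists_function (r : ℕ → ℕ → ℤ) (h0 : ∀ e, r e 0 = r 0 0)
    (h1 : ∀ e, r e (2 * q) = r 0 (2 * q)) : ∃ f : Fin (6 * q - 1) → ℤ,
      ∀ h, f (pantsVert hq hL h) = r (pantsStrand q h.1 h.2) (pantsPos q h.2) := by
  refine ⟨fun v => r ((v.val + 1) % 3) (if v.val = 0 then 0 else if v.val = 1 then 2 * q
      else (v.val + 1) / 3), fun h => ?_⟩
  change r ((pantsCode q _ _ + 1) % 3) _ = _
  have e : (if (pantsVert hq hL h).val = 0 then 0 else if (pantsVert hq hL h).val = 1 then 2 * q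
    else ((pantsVert hq hL h).val + 1) / 3) = pantsPos q h.2 :=
      pantsCode_div (pantsStrand_lt _ h.1.2)
  rw [e]
  by_cases c0 : pantsPos q h.2 = 0
  · rw [c0, h0, h0 (pantsStrand _ _ _)]
  by_cases c1 : pantsPos q h.2 = 2 * q
  · rw [c1, h1, h1 (pantsStrand _ _ _)]
  · rw [(pantsCode_mod (pantsStrand_lt _ h.1.2) c0 c1).1]

/-- Crossing an edge keeps the strand and moves the position by at most one, so a function that is
Lipschitz along every strand and agrees at the common ends bounds distances in the graph. -/
theorem pants_edist (r : ℕ → ℕ → ℤ) (h0 : ∀ e, r e 0 = r 0 0)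
    (h1 : ∀ e, r e (2 * q) = r 0 (2 * q)) (h2 : ∀ e p, |r e (p + 1) - r e p| ≤ 1)
    (h h' : Fin 3 × Fin (L + 1))
    (hr : (q : ℤ) ≤ |r (pantsStrand q h.1 h.2) (pantsPos q h.2) -
      r (pantsStrand q h'.1 h'.2) (pantsPos q h'.2)|) :
    (L : ℕ∞) ≤ 4 * (pants hq hL s hs).fatgraph.graph.edist (pantsVert hq hL h)
      (pantsVert hq hL h') := by
  obtain ⟨f, hf⟩ := pants_exists_function hq hL r h0 h1
  refine TaggedFatgraph.le_edist_of_lipschitz (pants hq hL s hs).fatgraph f ?_ _ _ ?_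
  · intro (h : Fin 3 × Fin (L + 1))
    have hd : 2 * q < L := by omega
    change |f (pantsVert hq hL (pantsOpp hd h)) - f (pantsVert hq hL h)| ≤ 1
    rw [hf, hf, pants_opp_strand hL]
    obtain ⟨b1, b2⟩ := pants_opp_pos hL hd h
    rcases lt_trichotomy (pantsPos q (pantsOpp hd h).2) (pantsPos q h.2) with c | c | c
    · rw [show pantsPos q h.2 = pantsPos q (pantsOpp hd h).2 + 1 by omega, abs_sub_comm]
      exact h2 _ _
    · rw [c]; simp
    · rw [show pantsPos q (pantsOpp hd h).2 = pantsPos q h.2 + 1 by omega]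
      exact h2 _ _
  · rw [hf, hf]
    have : (L : ℤ) = 4 * q := by omega
    linarith

theorem pants_isThin : (pants hq hL s hs).fatgraph.IsThin L := by
  refine ⟨Gluing.fatgraph_boundaryIn _, Gluing.fatgraph_isTrivalent _, ?_⟩
  intro u v huv hu hv
  obtain ⟨(h : Fin 3 × Fin (L + 1)), rfl⟩ := (pants hq hL s hs).vert_surjective u
  obtain ⟨(h' : Fin 3 × Fin (L + 1)), rfl⟩ := (pants hq hL s hs).vert_surjective v
  have hu := pants_valence_eq_three hq hL s hs hu
  have hv := pants_valence_eq_three hq hL s hs hv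
  have huv : ¬ pantsVert hq hL h = pantsVert hq hL h' := huv
  rw [pantsVert_eq_iff] at huv
  by_cases e : pantsPos q h.2 = pantsPos q h'.2
  · have hne : pantsStrand q h'.1 h'.2 ≠ pantsStrand q h.1 h.2 := fun e' => huv ⟨e, Or.inl e'.symm⟩
    have hq1 : pantsPos q h.2 = q := by
      by_contra hcon
      exact huv ⟨e, by omega⟩
    -- Distinct trivalent vertices at equal positions are the tagged midpoints of two strands.
    -- Distance to the first midpoint along its strand, extended by `q` over the other strands,
    -- separates them.
    refine pants_edist hq hL s hs
      (fun e p => if e = pantsStrand q h.1 h.2 then |(p : ℤ) - q| else q) ?_ ?_ ?_ h h' ?_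
    · intro e
      simp
    · intro e
      have : |((2 * q : ℕ) : ℤ) - q| = q := by
        rw [show ((2 * q : ℕ) : ℤ) - q = q by push_cast; ring]; simp
      simp only [this]
      split_ifs <;> rfl
    · intro e p
      split_ifs
      · have := abs_abs_sub_abs_le (((p + 1 : ℕ) : ℤ) - q) ((p : ℤ) - q)
        refine this.trans ?_
        rw [show ((p + 1 : ℕ) : ℤ) - q - ((p : ℤ) - q) = 1 by push_cast; ring]
        simp
      · simp
    · simp [hne, hq1]
  -- Otherwise the positions are two different values among `0`, `q` and `2q`, and position itself
  -- separates the vertices.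
  · refine pants_edist hq hL s hs (fun _ p => (p : ℤ)) (by simp) (by simp) (by simp) h h' ?_
    rw [le_abs]
    omega

theorem pants_boundary :
    (pants hq hL s hs).fatgraph.boundary L = ∑ j, Pi.single (s j) 1 := by
  let : Fintype (pants hq hL s hs).J := inferInstanceAs (Fintype (Fin 3))
  rw [Gluing.fatgraph_boundary]
  rfl

end GoodPants

/-! ### Cyclic words as periodic sequences. -/

namespace GoodPants

variable {k L : ℕ}

/-- A periodic biinfinite reduced word, that is, a cyclically reduced cyclic word of length `L` with
a base point. -/
structure IsLoopSeq (L : ℕ) (W : ℤ → Letter k) : Prop where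
  periodic : ∀ n, W (n + L) = W n
  reduced : ∀ n, W (n + 1) ≠ (W n).inv

/-- The inverse of a biinfinite word, shifted by `d`. -/
def flip (d : ℤ) (W : ℤ → Letter k) (n : ℤ) : Letter k := (W (d - 1 - n)).inv

theorem flip_flip (d e : ℤ) (W : ℤ → Letter k) (n : ℤ) : flip e (flip d W) n = W (n + (d - e)) := by
  unfold flip
  rw [Letter.inv_inv]
  congr 1
  ring

theorem flip_flip_self (d : ℤ) (W : ℤ → Letter k) : flip d (flip d W) = W := by
  funext n
  rw [flip_flip]
  simp

namespace IsLoopSeq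

variable {W : ℤ → Letter k} (hW : IsLoopSeq L W)

include hW

theorem shift (d : ℤ) : IsLoopSeq L (fun n => W (n + d)) :=
  ⟨fun n => by rw [add_right_comm]; exact hW.periodic _,
    fun n => by rw [add_right_comm]; exact hW.reduced _⟩

theorem flip (d : ℤ) : IsLoopSeq L (flip d W) := by
  refine ⟨fun n => ?_, fun n => ?_⟩
  · unfold GoodPants.flip
    rw [← hW.periodic (d - 1 - (n + L))]
    congr 2
    ring
  · unfold GoodPants.flip
    have h := hW.reduced (d - 1 - (n + 1))
    rw [show d - 1 - (n + 1) + 1 = d - 1 - n by ring] at h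
    rw [Letter.inv_inv]
    exact fun e => h e.symm

theorem add_mul (n c : ℤ) : W (n + L * c) = W n := by
  induction c using Int.induction_on with
  | zero => simp
  | succ c ih => rw [← ih, mul_add, mul_one, ← add_assoc, hW.periodic]
  | pred c ih => rw [← ih, ← hW.periodic (n + L * (-c - 1))]; congr 1; ring

theorem emod (n : ℤ) : W (n % L) = W n := by
  rw [← hW.add_mul (n % L) (n / L), Int.emod_add_mul_ediv]

end IsLoopSeq

section Loops

variable [NeZero L]

/-- The residue of an integer, as a position in a word of length `L`. -/
def residue (L : ℕ) [NeZero L] (n : ℤ) : Fin L :=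
  ⟨(n % L).toNat, by
    have h : (0 : ℤ) < L := by exact_mod_cast Nat.pos_of_ne_zero (NeZero.ne L)
    have := Int.emod_lt_of_pos n h
    have := Int.emod_nonneg n h.ne'
    omega⟩

theorem residue_val (n : ℤ) : ((residue L n).val : ℤ) = n % L := by
  have h : (0 : ℤ) < L := by exact_mod_cast Nat.pos_of_ne_zero (NeZero.ne L)
  exact Int.toNat_of_nonneg (Int.emod_nonneg n h.ne')

theorem residue_natCast (i : Fin L) : residue L (i.val : ℤ) = i := by
  ext
  zify
  rw [residue_val]
  exact Int.emod_eq_of_lt (by omega) (by omega)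

theorem residue_add_one (n : ℤ) : residue L (n + 1) = finRotate L (residue L n) := by
  ext
  zify
  have e := residue_val (L := L) (n + 1)
  rw [← Int.emod_add_emod, ← residue_val n] at e
  rw [e, val_finRotate]
  have := (residue L n).2
  split_ifs with h
  · rw [show ((residue L n).val : ℤ) + 1 = L by omega]; simp
  · rw [Int.emod_eq_of_lt (by omega) (by omega)]; simp

/-- The biinfinite word of a tagged loop, based at the tag. -/
def TaggedLoop.seq (s : TaggedLoop k L) (n : ℤ) : Letter k := s.word (residue L n)

theorem TaggedLoop.seq_natCast (s : TaggedLoop k L) (i : Fin L) : s.seq (i.val : ℤ) = s.word i := by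
  rw [seq, residue_natCast]

theorem TaggedLoop.isLoopSeq (s : TaggedLoop k L) : IsLoopSeq L s.seq := by
  refine ⟨fun n => ?_, fun n => ?_⟩
  · unfold seq
    congr 1
    ext
    zify
    rw [residue_val, residue_val]
    simp
  · unfold seq
    rw [residue_add_one]
    exact s.reduced _

/-- The letters that can serve as a tag of a loop. -/
theorem card_tags {x y : Letter k} (h : x ≠ y) :
    Fintype.card {a : Letter k // a ≠ x ∧ a ≠ y} = 2 * k - 2 := by
  rw [Fintype.card_subtype]
  have : (Finset.univ.filter fun a : Letter k => a ≠ x ∧ a ≠ y) =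
      (Finset.univ.erase x).erase y := by
    ext a; simp [and_comm]
  rw [this, Finset.card_erase_of_mem (by simp [h.symm]), Finset.card_erase_of_mem (by simp)]
  simp
  omega

omit [NeZero L] in
theorem IsLoopSeq.reduced_zero {W : ℤ → Letter k} (hW : IsLoopSeq L W) : W 0 ≠ (W (-1)).inv := by
  have := hW.reduced (-1)
  simpa using this

/-- A loop with given word is determined by its tag. -/
def loopsOfSeq {W : ℤ → Letter k} (hW : IsLoopSeq L W) :
    {s : TaggedLoop k L // s.seq = W} ≃ {a : Letter k // a ≠ W 0 ∧ a ≠ (W (-1)).inv} where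
  toFun s := ⟨s.1.tag, by
    have hL := Nat.pos_of_ne_zero (NeZero.ne L)
    obtain ⟨s, rfl⟩ := s
    refine ⟨s.tag_ne_first _ ?_, s.tag_ne_last _ ?_⟩
    · zify; rw [residue_val]; simp
    · zify
      rw [residue_val, ← Int.add_mul_emod_self_left _ _ 1, Int.emod_eq_of_lt (by omega) (by omega)]
      ring⟩
  invFun a := ⟨{
    word := fun i => W i.val
    tag := a.1
    reduced := fun i => by
      rw [val_finRotate]
      split_ifs with h
      · rw [← hW.periodic, show ((0 : ℕ) : ℤ) + L = i.val + 1 by omega]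
        exact hW.reduced _
      · push_cast
        exact hW.reduced _
    tag_ne_first := fun i hi => by rw [hi]; exact a.2.1
    tag_ne_last := fun i hi => by
      have : W i.val = W (-1) := by rw [← hW.periodic (-1)]; congr 1; omega
      rw [this]
      exact a.2.2 }, by
      funext n
      simp only [TaggedLoop.seq]
      rw [residue_val, hW.emod]⟩
  left_inv s := by
    obtain ⟨s, rfl⟩ := s
    refine Subtype.ext (TaggedLoop.ext ?_ rfl)
    funext i
    exact s.seq_natCast i
  right_inv a := rfl

theorem exists_loop_of_seq (hk : 2 ≤ k) {W : ℤ → Letter k} (hW : IsLoopSeq L W) :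
    ∃ s : TaggedLoop k L, s.seq = W := by
  have h := card_tags hW.reduced_zero
  have : Nonempty {a : Letter k // a ≠ W 0 ∧ a ≠ (W (-1)).inv} :=
    Fintype.card_pos_iff.1 (by omega)
  obtain ⟨a⟩ := this
  exact ⟨((loopsOfSeq hW).symm a).1, ((loopsOfSeq hW).symm a).2⟩

-- The tag is only required to avoid two distinct letters among the `2k`. That the count is the same
-- for all words is what makes sums over all annuli constant.
open Classical in
theorem card_loops_of_seq {W : ℤ → Letter k} (hW : IsLoopSeq L W) :
    (Finset.univ.filter fun s : TaggedLoop k L => s.seq = W).card = 2 * k - 2 := by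
  rw [← Fintype.card_subtype, Fintype.card_congr (loopsOfSeq hW), card_tags hW.reduced_zero]

theorem isAnnular_of_seq {d : ℕ} {s t : TaggedLoop k L} (h : t.seq = flip d s.seq) :
    s.IsAnnular d t := by
  intro i i' hi
  rw [← s.seq_natCast, ← t.seq_natCast, h, flip]
  congr 1
  rcases hi with hi | hi
  · congr 1; omega
  · rw [← s.isLoopSeq.periodic]; congr 1; omega

/-- The condition on the words of three loops that bound a good pair of pants. -/
def IsPantsSeq (q : ℕ) (s : Fin 3 → TaggedLoop k L) : Prop :=
  ∀ j, ∀ n : ℤ, q ≤ n → n < 3 * q →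
    (s (finRotate 3 j)).seq (2 * q - 1 - n) = ((s j).seq n).inv

theorem IsPantsSeq.isPantsTriple {q : ℕ} {s : Fin 3 → TaggedLoop k L} (h : IsPantsSeq q s) :
    IsPantsTriple q s := by
  intro j i i' h1 h2 hi
  rw [← TaggedLoop.seq_natCast, ← TaggedLoop.seq_natCast, ← h j i (by omega) (by omega)]
  rcases hi with hi | hi
  · congr 1; omega
  · rw [← (s _).isLoopSeq.periodic (2 * q - 1 - i)]; congr 1; omega

end Loops

end GoodPants

/-! ### The semigroup of boundaries, and negation modulo `1`. -/

namespace GoodPants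

variable {k L : ℕ} [NeZero L]

/-- The boundaries of good annuli. -/
def annulusVectors (k L : ℕ) [NeZero L] : Set (TaggedLoop k L → ℤ) :=
  {v | ∃ (d : ℕ) (s t : TaggedLoop k L), L ≤ 4 * d ∧ 4 * d ≤ 3 * L ∧ t.seq = flip d s.seq ∧
    v = Pi.single s 1 + Pi.single t 1}

/-- The boundaries of good pairs of pants. -/
def pantsVectors (k L q : ℕ) [NeZero L] : Set (TaggedLoop k L → ℤ) :=
  {v | ∃ s : Fin 3 → TaggedLoop k L, IsPantsSeq q s ∧ v = ∑ j, Pi.single (s j) 1}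

/-- The semigroup of boundaries of collections of good pants and good annuli. -/
def boundingCone (k L q : ℕ) [NeZero L] : AddSubmonoid (TaggedLoop k L → ℤ) :=
  AddSubmonoid.closure (annulusVectors k L ∪ pantsVectors k L q)

/-- The rational vector of an integer vector. -/
def ratVector (v : TaggedLoop k L → ℤ) : LoopSpace k L := fun s => (v s : ℚ)

omit [NeZero L] in
theorem ratVector_add (v w : TaggedLoop k L → ℤ) :
    ratVector (v + w) = ratVector v + ratVector w := by
  funext s; simp [ratVector]

omit [NeZero L] in
theorem ratVector_single (s : TaggedLoop k L) :
    ratVector (Pi.single s 1) = Pi.single s 1 := by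
  funext t
  simp only [ratVector, Pi.single_apply]
  split_ifs <;> simp

omit [NeZero L] in
theorem bounds_of_isGoodPants {Y : TaggedFatgraph k} (h : Y.IsGoodPants L ∨ Y.IsGoodAnnulus L) :
    BoundsPantsAndAnnuli (Y.boundary L) :=
  ⟨1, fun _ => Y, fun _ => h, by simp⟩

/-- Good annuli and good pants built by gluing are also thin, so the same decomposition serves both
kinds of bounding. -/
theorem boundingCone_bounds {q : ℕ} (hL : L = 4 * q) {v : TaggedLoop k L → ℤ}
    (hv : v ∈ boundingCone k L q) :
    BoundsPantsAndAnnuli (ratVector v) ∧ BoundsThin (ratVector v) := by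
  have hL0 := NeZero.ne L
  have hq : 0 < q := by omega
  induction hv using AddSubmonoid.closure_induction with
  | mem v hv =>
    rcases hv with ⟨d, s, t, h1, h2, h3, rfl⟩ | ⟨s, hs, rfl⟩
    · have h := isAnnular_of_seq h3
      have hd0 : 0 < d := by omega
      have hd : d < L := by omega
      have e := annulus_boundary hd0 hd s t h
      rw [ratVector_add, ratVector_single, ratVector_single, ← e]
      exact ⟨bounds_of_isGoodPants (Or.inr (annulus_isGoodAnnulus hd0 hd s t h h1 h2)),
        _, annulus_isThin hd0 hd s t h h1 h2, rfl⟩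
    · have h := hs.isPantsTriple
      have e := pants_boundary hq hL s h
      have e2 : ratVector (∑ j, Pi.single (s j) 1) = ∑ j, Pi.single (s j) (1 : ℚ) := by
        rw [Fin.sum_univ_three, Fin.sum_univ_three]
        simp only [ratVector_add, ratVector_single]
      rw [e2, ← e]
      exact ⟨bounds_of_isGoodPants (Or.inl (pants_isGoodPants hq hL s h)),
        _, pants_isThin hq hL s h, rfl⟩
  | zero =>
    have : ratVector (0 : TaggedLoop k L → ℤ) = 0 := by funext s; simp [ratVector]
    rw [this]
    exact ⟨BoundsPantsAndAnnuli.zero, BoundsThin.zero⟩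
  | add v w _ _ hv hw =>
    rw [ratVector_add]
    exact ⟨hv.1.add hw.1, hv.2.add hw.2⟩

-- For a given loop on either side of an annulus, the word of the other side is forced and its tag
-- is free. Each loop thus occurs `2k - 2` times on each side.
open Classical in
theorem sum_annuli (d : ℕ) :
    ∑ p : TaggedLoop k L × TaggedLoop k L with p.2.seq = flip d p.1.seq,
      (Pi.single p.1 1 + Pi.single p.2 1 : TaggedLoop k L → ℤ) = (2 * (2 * k - 2) : ℕ) • 1 := by
  funext r
  have h1 : ∑ p : TaggedLoop k L × TaggedLoop k L with p.2.seq = flip d p.1.seq,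
      (Pi.single p.1 1 : TaggedLoop k L → ℤ) r = (2 * k - 2 : ℕ) := by
    rw [Finset.sum_filter, Fintype.sum_prod_type, Finset.sum_eq_single r]
    · simp only [Pi.single_eq_same]
      rw [← Finset.sum_filter, Finset.sum_const, card_loops_of_seq (r.isLoopSeq.flip d)]
      simp
    · intro s _ hs
      simp [hs.symm]
    · simp
  have h2 : ∑ p : TaggedLoop k L × TaggedLoop k L with p.2.seq = flip d p.1.seq,
      (Pi.single p.2 1 : TaggedLoop k L → ℤ) r = (2 * k - 2 : ℕ) := by
    rw [Finset.sum_filter, Fintype.sum_prod_type_right, Finset.sum_eq_single r]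
    · simp only [Pi.single_eq_same]
      rw [← Finset.sum_filter, Finset.sum_const, Finset.filter_congr (q := fun s : TaggedLoop k L =>
        s.seq = flip d r.seq), card_loops_of_seq (r.isLoopSeq.flip d)]
      · simp
      · intro s _
        exact ⟨fun e => by rw [e, flip_flip_self], fun e => by rw [e, flip_flip_self]⟩
    · intro s _ hs
      simp [hs.symm]
    · simp
  rw [Finset.sum_apply]
  simp only [Pi.add_apply, Finset.sum_add_distrib]
  rw [h1, h2]
  simp
  ring

/-- All the other annuli with the same offset complete the given one to a multiple of `1`. -/
theorem exists_sub_annulus {q : ℕ} {v : TaggedLoop k L → ℤ} (hv : v ∈ annulusVectors k L) :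
    ∃ n : ℕ, -v + n • 1 ∈ boundingCone k L q := by
  classical
  obtain ⟨d, s, t, h1, h2, h3, rfl⟩ := hv
  refine ⟨2 * (2 * k - 2), ?_⟩
  rw [← sum_annuli d, ← Finset.add_sum_erase _ _
    (show (s, t) ∈ Finset.univ.filter (fun p : TaggedLoop k L × TaggedLoop k L =>
      p.2.seq = flip d p.1.seq) by simpa using h3)]
  dsimp only
  rw [neg_add_cancel_left]
  refine AddSubmonoid.sum_mem _ fun p hp => AddSubmonoid.subset_closure (Or.inl ?_)
  exact ⟨d, p.1, p.2, h1, h2, (Finset.mem_filter.1 (Finset.mem_of_mem_erase hp)).2, rfl⟩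

/-- If both a vector and its negative become boundaries after adding a multiple of `1`, for all
generators, then this holds for the generated group. -/
theorem exists_add_mem_of_closure {q : ℕ} {S : Set (TaggedLoop k L → ℤ)}
    (hS : ∀ v ∈ S, (∃ n : ℕ, v + n • 1 ∈ boundingCone k L q) ∧
      ∃ n : ℕ, -v + n • 1 ∈ boundingCone k L q) {v : TaggedLoop k L → ℤ}
    (hv : v ∈ AddSubgroup.closure S) :
    (∃ n : ℕ, v + n • 1 ∈ boundingCone k L q) ∧ ∃ n : ℕ, -v + n • 1 ∈ boundingCone k L q := by
  induction hv using AddSubgroup.closure_induction with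
  | mem v hv => exact hS v hv
  | zero => exact ⟨⟨0, by simp [zero_mem]⟩, ⟨0, by simp [zero_mem]⟩⟩
  | add v w _ _ hv hw =>
    obtain ⟨⟨a, ha⟩, ⟨b, hb⟩⟩ := hv
    obtain ⟨⟨a', ha'⟩, ⟨b', hb'⟩⟩ := hw
    refine ⟨⟨a + a', ?_⟩, ⟨b + b', ?_⟩⟩
    · convert add_mem ha ha' using 1
      rw [add_smul]; abel
    · convert add_mem hb hb' using 1
      rw [add_smul]; abel
  | neg v _ hv => exact ⟨hv.2, by rw [neg_neg]; exact hv.1⟩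

theorem exists_add_mem_of_annuli {q : ℕ} {v : TaggedLoop k L → ℤ}
    (hv : v ∈ AddSubgroup.closure (annulusVectors k L)) :
    ∃ n : ℕ, v + n • 1 ∈ boundingCone k L q :=
  (exists_add_mem_of_closure (fun _ hv => ⟨⟨0, by
    rw [zero_smul, add_zero]; exact AddSubmonoid.subset_closure (Or.inl hv)⟩, exists_sub_annulus hv⟩) hv).1

end GoodPants

/-! ### The group of boundaries and the classes of cyclic words. -/

namespace GoodPants

variable {k L : ℕ} [NeZero L]

/-- The group generated by the boundaries of good annuli. -/
def annulusGroup (k L : ℕ) [NeZero L] : AddSubgroup (TaggedLoop k L → ℤ) :=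
  AddSubgroup.closure (annulusVectors k L)

theorem add_mem_annulusGroup {d : ℕ} {s t : TaggedLoop k L} (h1 : L ≤ 4 * d) (h2 : 4 * d ≤ 3 * L)
    (h : t.seq = flip d s.seq) :
    (Pi.single s 1 + Pi.single t 1 : TaggedLoop k L → ℤ) ∈ annulusGroup k L :=
  AddSubgroup.subset_closure ⟨d, s, t, h1, h2, h, rfl⟩

section

variable {q : ℕ} (hL : L = 4 * q) (hk : 2 ≤ k)

include hL hk

/-- Moving the tag by one letter changes the offset to a fixed inverse loop `x` from `2q` to `2q -
1`. Both offsets are admissible, and the difference of the two annuli cancels `x`. -/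
theorem sub_mem_annulusGroup_of_shift_one {s t : TaggedLoop k L}
    (h : t.seq = fun n => s.seq (n + 1)) :
    (Pi.single t 1 - Pi.single s 1 : TaggedLoop k L → ℤ) ∈ annulusGroup k L := by
  have := NeZero.ne L
  obtain ⟨x, hx⟩ := exists_loop_of_seq hk (s.isLoopSeq.flip (2 * q : ℕ))
  have h1 := add_mem_annulusGroup (by omega) (by omega) hx
  have hx2 : x.seq = flip (2 * q - 1 : ℕ) t.seq := by
    rw [hx, h]
    funext n
    unfold flip
    congr 2
    omega
  have h2 := add_mem_annulusGroup (by omega) (by omega) hx2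
  convert sub_mem h2 h1 using 1
  abel

theorem sub_mem_annulusGroup_of_shift_nat (c : ℕ) {s t : TaggedLoop k L}
    (h : t.seq = fun n => s.seq (n + c)) :
    (Pi.single t 1 - Pi.single s 1 : TaggedLoop k L → ℤ) ∈ annulusGroup k L := by
  induction c generalizing t with
  | zero =>
    -- Loops with the same word but perhaps different tags: both are shifts by one letter of a
    -- common loop `x`.
    obtain ⟨x, hx⟩ := exists_loop_of_seq hk (s.isLoopSeq.shift (-1))
    have h1 : s.seq = fun n => x.seq (n + 1) := by rw [hx]; simp
    have h2 : t.seq = fun n => x.seq (n + 1) := by rw [hx, h]; simp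
    convert sub_mem (sub_mem_annulusGroup_of_shift_one hL hk h2)
      (sub_mem_annulusGroup_of_shift_one hL hk h1) using 1
    abel
  | succ c ih =>
    obtain ⟨x, hx⟩ := exists_loop_of_seq hk (s.isLoopSeq.shift c)
    have h1 : t.seq = fun n => x.seq (n + 1) := by
      rw [hx, h]
      funext n
      dsimp only
      congr 1
      push_cast
      ring
    convert add_mem (sub_mem_annulusGroup_of_shift_one hL hk h1) (ih hx) using 1
    abel

theorem sub_mem_annulusGroup_of_shift (c : ℤ) {s t : TaggedLoop k L}
    (h : t.seq = fun n => s.seq (n + c)) :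
    (Pi.single t 1 - Pi.single s 1 : TaggedLoop k L → ℤ) ∈ annulusGroup k L := by
  rcases Int.eq_nat_or_neg c with ⟨c, rfl | rfl⟩
  · exact sub_mem_annulusGroup_of_shift_nat hL hk c h
  · rw [← neg_sub]
    refine neg_mem (sub_mem_annulusGroup_of_shift_nat hL hk c ?_)
    rw [h]; simp

theorem add_mem_annulusGroup_of_flip (e : ℤ) {s t : TaggedLoop k L} (h : t.seq = flip e s.seq) :
    (Pi.single s 1 + Pi.single t 1 : TaggedLoop k L → ℤ) ∈ annulusGroup k L := by
  obtain ⟨x, hx⟩ := exists_loop_of_seq hk (s.isLoopSeq.flip (2 * q : ℕ))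
  have h1 := add_mem_annulusGroup (by omega) (by omega) hx
  have h2 : t.seq = fun n => x.seq (n + (2 * q - e)) := by
    rw [hx, h]
    funext n
    unfold flip
    congr 2
    push_cast
    ring
  convert add_mem h1 (sub_mem_annulusGroup_of_shift hL hk _ h2) using 1
  abel

/-- The inverse loops bound the pants whose strands are read backwards. Each loop plus its inverse
is a combination of annuli, so the negative of the pants equals the inverse pants minus annuli, and
the annuli are negated modulo `1`. -/
theorem exists_sub_pants {v : TaggedLoop k L → ℤ} (hv : v ∈ pantsVectors k L q) :
    ∃ n : ℕ, -v + n • 1 ∈ boundingCone k L q := by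
  obtain ⟨s, hs, rfl⟩ := hv
  choose t ht using fun j => exists_loop_of_seq hk ((s j).isLoopSeq.flip 0)
  have h1 : ∑ j, (Pi.single (t j) 1 : TaggedLoop k L → ℤ) ∈ boundingCone k L q := by
    refine AddSubmonoid.subset_closure (Or.inr ⟨t, ?_, rfl⟩)
    intro j n hn1 hn2
    have h := hs j (4 * q - 1 - n) (by omega) (by omega)
    have hp := (s j).isLoopSeq.periodic (-1 - n)
    rw [show -1 - n + (L : ℤ) = 4 * q - 1 - n by omega] at hp
    rw [hp] at h
    rw [ht, ht]
    unfold flip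
    rw [Letter.inv_inv, show (0 : ℤ) - 1 - n = -1 - n by ring, eq_comm, Letter.eq_inv_comm, ← h]
    congr 1
    ring
  have h2 : ∑ j, (Pi.single (s j) 1 + Pi.single (t j) 1 : TaggedLoop k L → ℤ) ∈
      annulusGroup k L :=
    sum_mem fun j _ => add_mem_annulusGroup_of_flip hL hk 0 (ht j)
  obtain ⟨n, hn⟩ := exists_add_mem_of_annuli (q := q) (neg_mem h2)
  refine ⟨n, ?_⟩
  convert add_mem h1 hn using 1
  rw [Finset.sum_add_distrib]
  abel

/-- The group generated by the boundaries of good annuli and good pairs of pants. -/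
def boundingGroup (k L q : ℕ) [NeZero L] : AddSubgroup (TaggedLoop k L → ℤ) :=
  AddSubgroup.closure (annulusVectors k L ∪ pantsVectors k L q)

theorem exists_add_mem_of_boundingGroup {v : TaggedLoop k L → ℤ}
    (hv : v ∈ boundingGroup k L q) : ∃ n : ℕ, v + n • 1 ∈ boundingCone k L q := by
  refine (exists_add_mem_of_closure (fun v hv => ⟨⟨0, ?_⟩, ?_⟩) hv).1
  · rw [zero_smul, add_zero]
    exact AddSubmonoid.subset_closure hv
  · rcases hv with hv | hv
    · exact exists_sub_annulus hv
    · exact exists_sub_pants hL hk hv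

end

/-- The class of a cyclic word modulo the boundaries. -/
noncomputable def loopClass (L q : ℕ) [NeZero L] (W : ℤ → Letter k) :
    (TaggedLoop k L → ℤ) ⧸ boundingGroup k L q :=
  open Classical in
  if h : ∃ s : TaggedLoop k L, s.seq = W then QuotientAddGroup.mk (Pi.single h.choose 1) else 0

theorem annulusGroup_le (q : ℕ) : annulusGroup k L ≤ boundingGroup k L q :=
  AddSubgroup.closure_mono Set.subset_union_left

variable {q : ℕ} (hL : L = 4 * q) (hk : 2 ≤ k)

include hL hk

/-- The choice of tag in the definition is immaterial, since changing the tag is a combination of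
annuli. -/
theorem loopClass_seq (s : TaggedLoop k L) :
    loopClass L q s.seq = QuotientAddGroup.mk (Pi.single s 1) := by
  have h : ∃ t : TaggedLoop k L, t.seq = s.seq := ⟨s, rfl⟩
  rw [loopClass, dif_pos h, eq_comm, QuotientAddGroup.eq, neg_add_eq_sub]
  exact annulusGroup_le q (sub_mem_annulusGroup_of_shift hL hk 0 (by rw [h.choose_spec]; simp))

theorem loopClass_shift {W : ℤ → Letter k} (hW : IsLoopSeq L W) (c : ℤ) :
    loopClass L q (fun n => W (n + c)) = loopClass L q W := by
  obtain ⟨s, rfl⟩ := exists_loop_of_seq hk hW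
  obtain ⟨t, ht⟩ := exists_loop_of_seq hk (hW.shift c)
  rw [← ht, loopClass_seq hL hk, loopClass_seq hL hk, eq_comm, QuotientAddGroup.eq, neg_add_eq_sub]
  exact annulusGroup_le q (sub_mem_annulusGroup_of_shift hL hk c ht)

theorem loopClass_flip {W : ℤ → Letter k} (hW : IsLoopSeq L W) (c : ℤ) :
    loopClass L q (flip c W) = -loopClass L q W := by
  obtain ⟨s, rfl⟩ := exists_loop_of_seq hk hW
  obtain ⟨t, ht⟩ := exists_loop_of_seq hk (hW.flip c)
  rw [← ht, loopClass_seq hL hk, loopClass_seq hL hk, eq_comm, ← QuotientAddGroup.mk_neg,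
    QuotientAddGroup.eq, neg_neg]
  exact annulusGroup_le q (add_mem_annulusGroup_of_flip hL hk c ht)

/-- Three words that can be spelled along the strands of a pair of pants. -/
theorem loopClass_triangle {W : Fin 3 → ℤ → Letter k} (hW : ∀ j, IsLoopSeq L (W j))
    (h : ∀ j, ∀ n : ℤ, 0 ≤ n → n < 2 * q → W (finRotate 3 j) n = (W j (4 * q - 1 - n)).inv) :
    ∑ j, loopClass L q (W j) = 0 := by
  -- The words `W j` start at a branch vertex, whereas tags sit at the middles of the strands, `q`
  -- letters later.
  choose s hs using fun j => exists_loop_of_seq hk ((hW j).shift q)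
  have e : ∀ j, loopClass L q (W j) = QuotientAddGroup.mk (Pi.single (s j) 1) := by
    intro j
    rw [← loopClass_seq hL hk, hs, loopClass_shift hL hk (hW j)]
  simp only [e]
  rw [← QuotientAddGroup.mk_sum, QuotientAddGroup.eq_zero_iff]
  refine AddSubgroup.subset_closure (Or.inr ⟨s, ?_, rfl⟩)
  intro j n hn1 hn2
  rw [hs, hs]
  dsimp only
  rw [show 2 * (q : ℤ) - 1 - n + q = 3 * q - 1 - n by ring, h j _ (by omega) (by omega)]
  congr 2
  ring

end GoodPants

/-! ### Cocycles on the graph of words. -/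

namespace GoodPants

/-- The rank hypothesis enters through the existence of at least four letters. -/
theorem exists_letter_ne {k : ℕ} (hk : 2 ≤ k) (x y z : Letter k) :
    ∃ w : Letter k, w ≠ x ∧ w ≠ y ∧ w ≠ z := by
  by_contra hcon
  push Not at hcon
  have h1 : (Finset.univ : Finset (Letter k)) ⊆ {x, y, z} := by
    intro w _
    simp only [Finset.mem_insert, Finset.mem_singleton]
    by_cases h1 : w = x
    · exact Or.inl h1
    by_cases h2 : w = y
    · exact Or.inr (Or.inl h2)
    · exact Or.inr (Or.inr (hcon w h1 h2))
  have h2 := (Finset.card_le_card h1).trans Finset.card_le_three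
  simp at h2
  omega

section Cocycle

variable {k : ℕ} {V Q : Type*}

/-- A function on words that only depends on the connected component in a link: `a` and `b` are the
first and last letter, and adjacent words differ in both. -/
theorem link_const (hk : 2 ≤ k) {a b : V → Letter k}
    (full : ∀ p q : Letter k, q ≠ p.inv → ∃ u, a u = p ∧ b u = q) (x y : Letter k) (e : V → Q)
    (he : ∀ t t', a t ≠ x → b t ≠ x → b t ≠ y → a t' ≠ x → b t' ≠ x → b t' ≠ y →
      a t ≠ a t' → b t ≠ b t' → e t = e t')
    (t t' : V) (h1 : a t ≠ x) (h2 : b t ≠ x) (h3 : b t ≠ y) (h1' : a t' ≠ x) (h2' : b t' ≠ x)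
    (h3' : b t' ≠ y) : e t = e t' := by
  have key : ∀ t t', a t ≠ x → b t ≠ x → b t ≠ y → a t' ≠ x → b t' ≠ x → b t' ≠ y →
      b t ≠ b t' → e t = e t' := by
    intro t t' h1 h2 h3 h1' h2' h3' hb
    by_cases ha : a t = a t'
    · obtain ⟨α, hα1, hα2, -⟩ := exists_letter_ne hk x (a t) x
      obtain ⟨β, hβ1, hβ2, hβ3⟩ := exists_letter_ne hk x (a t) α
      obtain ⟨p, r, hp1, hp2, hr1, hr2, hpr, hp3, hr3⟩ : ∃ p r : Letter k, p ≠ x ∧ p ≠ a t ∧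
          r ≠ x ∧ r ≠ a t ∧ p ≠ r ∧ b t' ≠ p.inv ∧ b t ≠ r.inv := by
        by_cases c : b t' ≠ α.inv ∧ b t ≠ β.inv
        · exact ⟨α, β, hα1, hα2, hβ1, hβ2, hβ3.symm, c.1, c.2⟩
        · refine ⟨β, α, hβ1, hβ2, hα1, hα2, hβ3, ?_, ?_⟩
          · intro h
            apply c
            refine ⟨fun h' => hβ3 (Letter.inv_inj.1 (h.symm.trans h')), fun h' => hb (h'.trans h.symm)⟩
          · intro h
            apply c
            refine ⟨fun h' => hb (h.trans h'.symm), fun h' => hβ3 (Letter.inv_inj.1 (h'.symm.trans h))⟩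
      obtain ⟨t1, ht1, ht1'⟩ := full p (b t') hp3
      obtain ⟨t2, ht2, ht2'⟩ := full r (b t) hr3
      rw [he t t1 h1 h2 h3 (ht1 ▸ hp1) (ht1' ▸ h2') (ht1' ▸ h3') (ht1 ▸ hp2.symm) (ht1' ▸ hb),
        he t1 t2 (ht1 ▸ hp1) (ht1' ▸ h2') (ht1' ▸ h3') (ht2 ▸ hr1) (ht2' ▸ h2) (ht2' ▸ h3)
          (by rwa [ht1, ht2]) (by rw [ht1', ht2']; exact hb.symm),
        he t2 t' (ht2 ▸ hr1) (ht2' ▸ h2) (ht2' ▸ h3) h1' h2' h3' (by rwa [ht2, ← ha])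
          (by rwa [ht2'])]
    · exact he t t' h1 h2 h3 h1' h2' h3' ha hb
  by_cases hb : b t = b t'
  · obtain ⟨q, hq1, hq2, hq3⟩ := exists_letter_ne hk x y (b t)
    obtain ⟨p, hp1, hp2, hp3⟩ := exists_letter_ne hk x (a t) q.inv
    obtain ⟨s, hs, hs'⟩ := full p q (fun h => hp3 (Letter.eq_inv_comm.1 h))
    rw [key t s h1 h2 h3 (hs ▸ hp1) (hs' ▸ hq1) (hs' ▸ hq2) (hs' ▸ hq3.symm),
      key s t' (hs ▸ hp1) (hs' ▸ hq1) (hs' ▸ hq2) h1' h2' h3' (by rw [hs', ← hb]; exact hq3)]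
  · exact key t t' h1 h2 h3 h1' h2' h3' hb

variable [AddCommGroup Q]

/-- A cocycle on the graph of words, in which words are adjacent if they differ in the first and in
the last letter, is a coboundary. -/
theorem exists_potential (hk : 2 ≤ k) (a b : V → Letter k)
    (full : ∀ p q : Letter k, q ≠ p.inv → ∃ u, a u = p ∧ b u = q) (c : V → V → Q)
    (anti : ∀ u v, a u ≠ a v → b u ≠ b v → c v u = -c u v)
    (tri : ∀ u v w, a u ≠ a v → b u ≠ b v → a v ≠ a w → b v ≠ b w → a u ≠ a w → b u ≠ b w →
      c u v + c v w = c u w) :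
    ∃ f : V → Q, ∀ u v, a u ≠ a v → b u ≠ b v → c u v = f u - f v := by
  classical
  -- The base vertex `o` starts and ends with `x`. The potential at `u` is the value of the cocycle
  -- along a path of length two from `u` to `o`.
  set x : Letter k := (⟨0, by omega⟩, true) with hx
  obtain ⟨o, ho, ho'⟩ := full x x x.inv_ne.symm
  have common : ∀ y z : Letter k, ∃ t, a t ≠ x ∧ a t ≠ y ∧ b t ≠ x ∧ b t ≠ z := by
    intro y z
    obtain ⟨p, hp1, hp2, -⟩ := exists_letter_ne hk x y x
    obtain ⟨q, hq1, hq2, hq3⟩ := exists_letter_ne hk x z p.inv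
    obtain ⟨t, ht, ht'⟩ := full p q hq3
    exact ⟨t, ht ▸ hp1, ht ▸ hp2, ht' ▸ hq1, ht' ▸ hq2⟩
  have move : ∀ u t t', a t ≠ x → b t ≠ x → a t' ≠ x → b t' ≠ x → a u ≠ a t → b u ≠ b t →
      a u ≠ a t' → b u ≠ b t' → a t ≠ a t' → b t ≠ b t' → c u t + c t o = c u t' + c t' o := by
    intro u t t' h1 h2 h3 h4 h5 h6 h7 h8 h9 h10
    rw [← tri u t t' h5 h6 h9 h10 h7 h8, ← tri t t' o h9 h10 (ho ▸ h3) (ho' ▸ h4) (ho ▸ h1)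
      (ho' ▸ h2)]
    abel
  -- If `u` agrees with `o` at one end, a common neighbour must avoid only one letter there and at
  -- most two at the other end. This is the situation of `link_const`, used with the two ends
  -- exchanged in the second case. If `u` is adjacent to `o`, triangles suffice.
  have indep : ∀ u t t', a t ≠ x → b t ≠ x → a t' ≠ x → b t' ≠ x → a u ≠ a t → b u ≠ b t →
      a u ≠ a t' → b u ≠ b t' → c u t + c t o = c u t' + c t' o := by
    intro u t t' h1 h2 h3 h4 h5 h6 h7 h8
    by_cases hu : a u = x
    · exact link_const hk full x (b u) (fun t => c u t + c t o)
        (fun s s' g1 g2 g3 g1' g2' g3' g4 g5 => move u s s' g1 g2 g1' g2' (hu ▸ g1.symm) g3.symm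
          (hu ▸ g1'.symm) g3'.symm g4 g5) t t' h1 h2 h6.symm h3 h4 h8.symm
    by_cases hu' : b u = x
    · exact link_const (a := b) (b := a) hk
        (fun p q hpq => by
          obtain ⟨t, ht, ht'⟩ := full q p fun h => hpq (Letter.eq_inv_comm.1 h)
          exact ⟨t, ht', ht⟩)
        x (a u) (fun t => c u t + c t o)
        (fun s s' g1 g2 g3 g1' g2' g3' g4 g5 => move u s s' g2 g1 g2' g1' g3.symm (hu' ▸ g1.symm)
          g3'.symm (hu' ▸ g1'.symm) g5 g4) t t' h2 h1 h5.symm h4 h3 h7.symm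
    · rw [tri u t o h5 h6 (ho ▸ h1) (ho' ▸ h2) (ho ▸ hu) (ho' ▸ hu'),
        tri u t' o h7 h8 (ho ▸ h3) (ho' ▸ h4) (ho ▸ hu) (ho' ▸ hu')]
  choose τ h1 h2 h3 h4 using fun u => common (a u) (b u)
  set f : V → Q := fun u => c u (τ u) + c (τ u) o with hf
  have f_eq : ∀ u t, a t ≠ x → b t ≠ x → a u ≠ a t → b u ≠ b t → f u = c u t + c t o :=
    fun u t g1 g2 g3 g4 => indep u (τ u) t (h1 u) (h3 u) g1 g2 (h2 u).symm (h4 u).symm g3 g4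
  have f_base : ∀ u, a u ≠ x → b u ≠ x → f u = c u o := by
    intro u g1 g2
    exact tri u (τ u) o (h2 u).symm (h4 u).symm (ho ▸ h1 u) (ho' ▸ h3 u) (ho ▸ g1) (ho' ▸ g2)
  refine ⟨f, fun u v ha hb => ?_⟩
  by_cases hu : a u ≠ x ∧ b u ≠ x
  · rw [f_base u hu.1 hu.2, f_eq v u hu.1 hu.2 ha.symm hb.symm, anti u v ha hb]
    abel
  by_cases hv : a v ≠ x ∧ b v ≠ x
  · rw [f_base v hv.1 hv.2, f_eq u v hv.1 hv.2 ha hb]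
    abel
  -- Neither `u` nor `v` is adjacent to `o`, but they are adjacent to each other. So at each end one
  -- of them has the letter `x`, and a common neighbour of all three avoids only two letters per
  -- end.
  have both : ∃ t, a t ≠ x ∧ b t ≠ x ∧ a u ≠ a t ∧ b u ≠ b t ∧ a v ≠ a t ∧ b v ≠ b t := by
    by_cases hu' : a u = x
    · have hv' : b v = x := by
        by_contra h
        exact hv ⟨fun h' => ha (hu'.trans h'.symm), h⟩
      obtain ⟨t, g1, g2, g3, g4⟩ := common (a v) (b u)
      exact ⟨t, g1, g3, hu' ▸ g1.symm, g4.symm, g2.symm, hv' ▸ g3.symm⟩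
    · have hu'' : b u = x := by
        by_contra h
        exact hu ⟨hu', h⟩
      have hv' : a v = x := by
        by_contra h
        exact hv ⟨h, fun h' => hb (hu''.trans h'.symm)⟩
      obtain ⟨t, g1, g2, g3, g4⟩ := common (a u) (b v)
      exact ⟨t, g1, g3, g2.symm, hu'' ▸ g3.symm, hv' ▸ g1.symm, g4.symm⟩
  obtain ⟨t, g1, g2, g3, g4, g5, g6⟩ := both
  rw [f_eq u t g1 g2 g3 g4, f_eq v t g1 g2 g5 g6, ← tri u v t ha hb g5 g6 g3 g4]
  abel

end Cocycle

end GoodPants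

/-! ### A potential on words of half the length. -/

namespace GoodPants

/-- The word in positions `0, …, m - 1` is reduced. -/
def IsReducedTo {k : ℕ} (m : ℤ) (u : ℤ → Letter k) : Prop :=
  ∀ n, 0 ≤ n → n + 1 < m → u (n + 1) ≠ (u n).inv

theorem isLoopSeq_emod {k L : ℕ} (hL : 0 < L) {X : ℤ → Letter k} (hX : IsReducedTo L X)
    (h0 : X 0 ≠ (X (L - 1)).inv) : IsLoopSeq L (fun n => X (n % L)) := by
  refine ⟨fun n => by simp, fun n => ?_⟩
  have h1 := Int.emod_lt_of_pos n (show (0 : ℤ) < L by exact_mod_cast hL)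
  have h2 := Int.emod_nonneg n (show (L : ℤ) ≠ 0 by exact_mod_cast hL.ne')
  change X ((n + 1) % L) ≠ (X (n % L)).inv
  rw [← Int.emod_add_emod]
  by_cases h : n % L + 1 < L
  · rw [Int.emod_eq_of_lt (by omega) h]
    exact hX _ h2 h
  · have h3 : n % L = L - 1 := by omega
    rw [h3]
    simpa using h0

/-- The cyclic word `u v⁻¹`, where `u` and `v` are words of length `m`. -/
def joinInv {k : ℕ} (m : ℕ) (u v : ℤ → Letter k) (n : ℤ) : Letter k :=
  if n < m then u n else (v (2 * m - 1 - n)).inv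

/-- Cancellation in `u v⁻¹` could occur only at the two junctions, where it would mean equal last
letters or equal first letters. -/
theorem joinInv_isLoopSeq {k m : ℕ} (hm : 0 < m) {u v : ℤ → Letter k} (hu : IsReducedTo m u)
    (hv : IsReducedTo m v) (h0 : u 0 ≠ v 0) (h1 : u (m - 1) ≠ v (m - 1)) :
    IsLoopSeq (2 * m) (fun n => joinInv m u v (n % (2 * m : ℕ))) := by
  refine isLoopSeq_emod (by omega) ?_ ?_
  · intro n hn hn'
    push_cast at hn'
    unfold joinInv
    by_cases h : n + 1 < m
    · rw [if_pos h, if_pos (by omega)]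
      exact hu n hn h
    rw [if_neg h]
    by_cases h' : n < m
    · rw [if_pos h', show 2 * (m : ℤ) - 1 - (n + 1) = m - 1 by omega,
        show n = (m : ℤ) - 1 by omega]
      exact fun e => h1 (Letter.inv_inj.1 e).symm
    · rw [if_neg h', Letter.inv_inv]
      have := hv (2 * m - 1 - (n + 1)) (by omega) (by omega)
      rw [show 2 * (m : ℤ) - 1 - (n + 1) + 1 = 2 * m - 1 - n by ring] at this
      exact fun e => this e.symm
  · unfold joinInv
    rw [if_pos (by omega), if_neg (by push_cast; omega), Letter.inv_inv]
    simpa using h0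

theorem exists_reduced_word {k m : ℕ} {p q : Letter k} (h : q ≠ p.inv) :
    IsReducedTo m (fun n : ℤ => if n = m - 1 then q else p) := by
  intro n hn hn'
  dsimp only
  rw [if_neg (show ¬ n = (m : ℤ) - 1 by omega)]
  split_ifs
  · exact h
  · exact p.inv_ne.symm

section Potential

variable {k m : ℕ} {Q : Type*} [AddCommGroup Q] {φ : (ℤ → Letter k) → Q}

/-- The value of `φ` on the joins `u v⁻¹` is a cocycle: inversion gives antisymmetry, and pants give
the triangle relation. Every loop is such a join of its first half with the first half of its
inverse. -/
theorem exists_word_potential (hk : 2 ≤ k) (hm : 2 ≤ m)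
    (hflip : ∀ W, IsLoopSeq (2 * m) W → ∀ c, φ (flip c W) = -φ W)
    (htri : ∀ W : Fin 3 → ℤ → Letter k, (∀ j, IsLoopSeq (2 * m) (W j)) →
      (∀ j, ∀ n : ℤ, 0 ≤ n → n < m → W (finRotate 3 j) n = (W j (2 * m - 1 - n)).inv) →
      ∑ j, φ (W j) = 0) :
    ∃ f : (ℤ → Letter k) → Q, (∀ u v, IsReducedTo m u →
      (∀ n : ℤ, 0 ≤ n → n < m → u n = v n) → f u = f v) ∧
      ∀ W, IsLoopSeq (2 * m) W → φ W = f W - f (flip 0 W) := by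
  classical
  let V := {u : ℤ → Letter k // IsReducedTo m u}
  set J : (ℤ → Letter k) → (ℤ → Letter k) → ℤ → Letter k :=
    fun u v n => joinInv m u v (n % (2 * m : ℕ)) with hJ
  have hJl : ∀ u v (n : ℤ), 0 ≤ n → n < m → J u v n = u n := by
    intro u v n h1 h2
    simp only [hJ]
    rw [Int.emod_eq_of_lt h1 (by push_cast; omega), joinInv, if_pos h2]
  have hJr : ∀ u v (n : ℤ), 0 ≤ n → n < m → J u v (2 * m - 1 - n) = (v n).inv := by
    intro u v n h1 h2
    simp only [hJ]
    rw [Int.emod_eq_of_lt (by omega) (by push_cast; omega), joinInv, if_neg (by omega)]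
    congr 2
    ring
  have hloop : ∀ u v : V, u.1 0 ≠ v.1 0 → u.1 (m - 1) ≠ v.1 (m - 1) →
      IsLoopSeq (2 * m) (J u.1 v.1) :=
    fun u v h h' => joinInv_isLoopSeq (by omega) u.2 v.2 h h'
  have hJflip : ∀ u v, J v u = flip 0 (J u v) := by
    intro u v
    funext n
    simp only [hJ, flip]
    have h1 := Int.emod_lt_of_pos n (show (0 : ℤ) < (2 * m : ℕ) by omega)
    have h2 := Int.emod_nonneg n (show ((2 * m : ℕ) : ℤ) ≠ 0 by omega)
    have h3 : (0 - 1 - n) % ((2 * m : ℕ) : ℤ) = (2 * m : ℕ) - 1 - n % (2 * m : ℕ) := by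
      generalize ((2 * m : ℕ) : ℤ) = M at *
      calc (0 - 1 - n) % M = (M - 1 - n) % M := by
            rw [show M - 1 - n = M + (0 - 1 - n) by ring, Int.add_emod_left]
        _ = (M - 1 - n % M) % M := (Int.sub_emod_emod _ _ _).symm
        _ = _ := Int.emod_eq_of_lt (by omega) (by omega)
    rw [h3]
    generalize n % ((2 * m : ℕ) : ℤ) = r at *
    push_cast at *
    unfold joinInv
    by_cases h : r < m
    · rw [if_pos h, if_neg (by omega), Letter.inv_inv]
      congr 1
      ring
    · rw [if_neg h, if_pos (by omega)]
  obtain ⟨f, hf⟩ := exists_potential (V := V) hk (fun u => u.1 0) (fun u => u.1 (m - 1))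
    (fun p q hpq => ⟨⟨_, exists_reduced_word hpq⟩, if_neg (by omega), if_pos rfl⟩)
    (fun u v => φ (J u.1 v.1))
    (fun u v h h' => by
      rw [hJflip u.1 v.1, hflip _ (hloop u v h h')])
    (fun u v w h1 h2 h3 h4 h5 h6 => by
      have h := htri ![J u.1 v.1, J v.1 w.1, J w.1 u.1]
        (by
          intro j
          fin_cases j
          · exact hloop u v h1 h2
          · exact hloop v w h3 h4
          · exact hloop w u h5.symm h6.symm)
        (by
          intro j n hn hn'
          fin_cases j
          · exact (hJl _ _ n hn hn').trans ((Letter.inv_inv _).symm.trans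
              (congrArg _ (hJr _ _ n hn hn').symm))
          · exact (hJl _ _ n hn hn').trans ((Letter.inv_inv _).symm.trans
              (congrArg _ (hJr _ _ n hn hn').symm))
          · exact (hJl _ _ n hn hn').trans ((Letter.inv_inv _).symm.trans
              (congrArg _ (hJr _ _ n hn hn').symm)))
      rw [Fin.sum_univ_three] at h
      change φ (J u.1 v.1) + φ (J v.1 w.1) + φ (J w.1 u.1) = 0 at h
      rw [hJflip u.1 w.1, hflip _ (hloop u w h5 h6)] at h
      exact add_neg_eq_zero.1 h)
  have hJcongr : ∀ u u' v : ℤ → Letter k, (∀ n : ℤ, 0 ≤ n → n < m → u n = u' n) → J u v = J u' v := by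
    intro u u' v h
    funext n
    simp only [hJ, joinInv]
    have h2 := Int.emod_nonneg n (show ((2 * m : ℕ) : ℤ) ≠ 0 by omega)
    split_ifs with h'
    · exact h _ h2 h'
    · rfl
  have hred : ∀ u v : ℤ → Letter k, IsReducedTo m u → (∀ n : ℤ, 0 ≤ n → n < m → u n = v n) →
      IsReducedTo m v := by
    intro u v h h' n hn hn'
    rw [← h' n hn (by omega), ← h' (n + 1) (by omega) hn']
    exact h n hn hn'
  refine ⟨fun u => if h : IsReducedTo m u then f ⟨u, h⟩ else 0, fun u v hu huv => ?_,
    fun W hW => ?_⟩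
  · beta_reduce
    rw [dif_pos hu, dif_pos (hred u v hu huv)]
    -- Sequences that agree on the first `m` letters have the same join with a common neighbour `t`,
    -- hence the same potential.
    obtain ⟨p, hp, -, -⟩ := exists_letter_ne hk (u 0) (u 0) (u 0)
    obtain ⟨r, hr, hr', -⟩ := exists_letter_ne hk (u (m - 1)) p.inv p.inv
    let t : V := ⟨_, exists_reduced_word hr'⟩
    have ht : t.1 0 = p := if_neg (by omega)
    have ht' : t.1 (m - 1) = r := if_pos rfl
    have h1 := hf ⟨u, hu⟩ t (ht ▸ hp.symm) (ht' ▸ hr.symm)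
    have h2 := hf ⟨v, hred u v hu huv⟩ t (by
        change v 0 ≠ t.1 0
        rw [ht, ← huv 0 le_rfl (by omega)]
        exact hp.symm) (by
        change v (m - 1) ≠ t.1 (m - 1)
        rw [ht', ← huv (m - 1) (by omega) (by omega)]
        exact hr.symm)
    rw [show J u t.1 = J v t.1 from hJcongr u v t.1 huv, h2] at h1
    exact (sub_left_injective h1).symm
  · have hW' : IsReducedTo m W := fun n _ _ => hW.reduced n
    have hW'' : IsReducedTo m (flip 0 W) := fun n _ _ => (hW.flip 0).reduced n
    have hper : ∀ n, W (n - 2 * m) = W n := by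
      intro n
      rw [← hW.periodic]
      congr 1
      push_cast
      ring
    beta_reduce
    rw [dif_pos hW', dif_pos hW'', ← hf ⟨W, hW'⟩ ⟨_, hW''⟩]
    · congr 1
      funext n
      simp only [hJ, joinInv, flip]
      split_ifs
      · exact (hW.emod n).symm
      · rw [Letter.inv_inv, show 0 - 1 - (2 * (m : ℤ) - 1 - n % (2 * m : ℕ)) =
          n % (2 * m : ℕ) - 2 * m by ring, hper, hW.emod]
    · intro h
      have := hW.reduced_zero
      exact this (by simpa [flip] using h)
    · intro h
      simp only [flip] at h
      have := hW.reduced (m - 1)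
      rw [show 0 - 1 - ((m : ℤ) - 1) = m - 2 * m by ring, hper] at h
      rw [sub_add_cancel, h, Letter.inv_inv] at this
      exact this rfl

end Potential
end GoodPants

/-! ### Additivity in the letters. -/

namespace GoodPants

theorem IsLoopSeq.isReducedTo {k L : ℕ} {W : ℤ → Letter k} (hW : IsLoopSeq L W) (m : ℤ) :
    IsReducedTo m W :=
  fun n _ _ => hW.reduced n

section Additive

variable {k m : ℕ} {Q : Type*} [AddCommGroup Q] {φ f : (ℤ → Letter k) → Q}

/-- A potential of a class function changes under a shift of the word by one letter by a quantity
that depends only on the letters that leave and enter. -/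
theorem exists_shift_defect (hk : 2 ≤ k) (hm : 2 ≤ m)
    (hshift : ∀ W, IsLoopSeq (2 * m) W → φ (fun n => W (n + 1)) = φ W)
    (hcongr : ∀ u v, IsReducedTo m u → (∀ n : ℤ, 0 ≤ n → n < m → u n = v n) → f u = f v)
    (hf : ∀ W, IsLoopSeq (2 * m) W → φ W = f W - f (flip 0 W)) :
    ∃ g : Letter k → Letter k → Q, ∀ X : ℤ → Letter k, IsReducedTo (m + 1) X →
      f X - f (fun n => X (n + 1)) = g (X 0) (X m) := by
  -- The word `X` of length `m + 1` is closed up to the loop `X s ⋯ s`, where `s` depends only on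
  -- the end letters of `X`. In the potential formula for this loop and for its shift, the inverted
  -- halves then depend only on those letters too.
  choose σ h1 h2 _ using fun x z : Letter k => exists_letter_ne hk z.inv x.inv x.inv
  refine ⟨fun x z => f (fun n => if n < m - 1 then (σ x z).inv else z.inv) -
    f (fun n => if n = 0 then x.inv else (σ x z).inv), fun X hX => ?_⟩
  set s := σ (X 0) (X m)
  have hs1 : s ≠ (X m).inv := h1 _ _
  have hs2 : s ≠ (X 0).inv := h2 _ _
  set Y : ℤ → Letter k := fun n => if n ≤ m then X n else s with hY
  have hW : IsLoopSeq (2 * m) (fun n => Y (n % (2 * m : ℕ))) := by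
    refine isLoopSeq_emod (by omega) (fun n hn hn' => ?_) ?_
    · simp only [hY]
      split_ifs with c1 c2 c2
      · exact hX n hn (by omega)
      · omega
      · rw [show n = (m : ℤ) by omega]
        exact hs1
      · exact s.inv_ne.symm
    · simp only [hY]
      rw [if_pos (by omega), if_neg (by push_cast; omega)]
      exact fun e => hs2 (Letter.eq_inv_comm.1 e)
  set W : ℤ → Letter k := fun n => Y (n % (2 * m : ℕ)) with hWdef
  have hWn : ∀ n : ℤ, 0 ≤ n → n ≤ m → W n = X n := by
    intro n hn hn'
    simp only [hWdef, hY]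
    rw [Int.emod_eq_of_lt hn (by push_cast; omega), if_pos hn']
  have hWs : ∀ n : ℤ, m < n → n < 2 * m → W n = s := by
    intro n hn hn'
    simp only [hWdef, hY]
    rw [Int.emod_eq_of_lt (by omega) (by push_cast; omega), if_neg (by omega)]
  have hper : ∀ n, W n = W (n + 2 * m) := by
    intro n
    rw [← hW.periodic]
    congr 1
  have e := hshift W hW
  have hW1 := hW.shift 1
  rw [hf _ hW, hf _ hW1] at e
  rw [hcongr W X (hW.isReducedTo m) fun n h h' => hWn n h h'.le,
    hcongr _ (fun n => X (n + 1)) (hW1.isReducedTo m) fun n h h' => hWn (n + 1) (by omega) (by omega),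
    hcongr _ (fun n => if n < m - 1 then s.inv else (X m).inv) ((hW.flip 0).isReducedTo m) (by
      intro n h h'
      simp only [flip]
      rw [hper]
      split_ifs with c
      · rw [hWs _ (by omega) (by omega)]
      · rw [show 0 - 1 - n + 2 * m = (m : ℤ) by omega, hWn _ (by omega) le_rfl]),
    hcongr _ (fun n => if n = 0 then (X 0).inv else s.inv) ((hW1.flip 0).isReducedTo m) (by
      intro n h h'
      simp only [flip]
      split_ifs with c
      · rw [show 0 - 1 - n + 1 = (0 : ℤ) by omega, hWn _ le_rfl (by omega)]
      · rw [hper, hWs _ (by omega) (by omega)])] at e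
  rw [sub_eq_sub_iff_add_eq_add] at e ⊢
  exact e.symm.trans (add_comm _ _)

/-- A potential of a class function is additive in the letters, up to torsion. -/
theorem potential_additive (hk : 2 ≤ k) (hm : 2 ≤ m)
    (hshift : ∀ W, IsLoopSeq (2 * m) W → φ (fun n => W (n + 1)) = φ W)
    (hcongr : ∀ u v, IsReducedTo m u → (∀ n : ℤ, 0 ≤ n → n < m → u n = v n) → f u = f v)
    (hf : ∀ W, IsLoopSeq (2 * m) W → φ W = f W - f (flip 0 W))
    {u : ℤ → Letter k} (hu : IsReducedTo m u) :
    m • f u = ∑ i ∈ Finset.range m, f (fun _ => u i) := by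
  obtain ⟨g, hg⟩ := exists_shift_defect hk hm hshift hcongr hf
  -- A window of length `m` slides from `u` to `z` along the concatenation `u z`; at step `i` the
  -- letter `u i` leaves and `z i` enters.
  have move : ∀ u z : ℤ → Letter k, IsReducedTo m u → IsReducedTo m z → z 0 ≠ (u (m - 1)).inv →
      f u - f z = ∑ i ∈ Finset.range m, g (u i) (z i) := by
    intro u z hu hz huz
    set X : ℤ → Letter k := fun n => if n < m then u n else z (n - m) with hX
    have hXr : IsReducedTo (2 * m) X := by
      intro n hn hn'
      simp only [hX]
      split_ifs with c1 c2 c2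
      · exact hu n hn c1
      · omega
      · rw [show n = (m : ℤ) - 1 by omega]
        simpa using huz
      · rw [show n + 1 - m = n - m + 1 by ring]
        exact hz _ (by omega) (by omega)
    have step : ∀ i ∈ Finset.range m, g (u i) (z i) =
        f (fun n => X (n + i)) - f (fun n => X (n + (i + 1 : ℕ))) := by
      intro i hi
      rw [Finset.mem_range] at hi
      have h := hg (fun n => X (n + i)) fun n hn hn' => by
        dsimp only
        rw [add_right_comm]
        exact hXr _ (by omega) (by omega)
      have e1 : X (0 + i) = u i := by
        simp only [hX]
        rw [if_pos (by omega), zero_add]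
      have e2 : X (m + i) = z i := by
        simp only [hX]
        rw [if_neg (by omega), add_sub_cancel_left]
      rw [e1, e2] at h
      rw [← h]
      congr 2
      funext n
      congr 1
      push_cast
      ring
    rw [Finset.sum_congr rfl step, Finset.sum_range_sub']
    congr 1
    · exact hcongr _ _ hu fun n _ h => by simp [hX, h]
    · exact hcongr _ _ hz fun n h _ => by simp [hX, h]
  have const_red : ∀ x : Letter k, IsReducedTo m (fun _ => x) := fun x n _ _ => x.inv_ne.symm
  have hF : ∀ x y : Letter k, y ≠ x.inv → f (fun _ => x) - f (fun _ => y) = m • g x y := by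
    intro x y hxy
    rw [move _ _ (const_red x) (const_red y) hxy]
    simp
  -- Sliding between constant words gives `m • g x y = f (x ⋯ x) - f (y ⋯ y)` unless `y` is inverse
  -- to `x`. So the failure of additivity is the same for `u` and `z`.
  have transfer : ∀ u z : ℤ → Letter k, IsReducedTo m u → IsReducedTo m z →
      z 0 ≠ (u (m - 1)).inv → (∀ i, z i ≠ (u i).inv) →
      m • f u - ∑ i ∈ Finset.range m, f (fun _ => u i) =
        m • f z - ∑ i ∈ Finset.range m, f (fun _ => z i) := by
    intro u z hu hz h0 h
    rw [sub_eq_sub_iff_sub_eq_sub, ← smul_sub, move u z hu hz h0, ← Finset.sum_sub_distrib,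
      Finset.smul_sum]
    exact Finset.sum_congr rfl fun i _ => (hF _ _ (h i)).symm
  -- The failure is moved from `u` to a constant word, where it vanishes, through a word `z` whose
  -- letters all have the sign of the last letter of `u`. Letters of equal sign are never inverse,
  -- and having both `a` and `b` available lets `z` avoid the inverses of the letters of `u`.
  set σ := (u (m - 1)).2 with hσ
  set a : Letter k := (⟨0, by omega⟩, σ) with ha
  set b : Letter k := (⟨1, by omega⟩, σ) with hb
  have hab : b ≠ a := by simp [ha, hb]
  set z : ℤ → Letter k := fun n => if a = (u n).inv then b else a with hz
  have hz2 : ∀ n, (z n).2 = σ := by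
    intro n
    simp only [hz]
    split_ifs <;> rfl
  have ne_of_sign : ∀ x y : Letter k, x.2 = y.2 → x ≠ y.inv := by
    intro x y hxy e
    rw [e] at hxy
    simp [Letter.inv] at hxy
  have hzr : IsReducedTo m z := fun n _ _ => ne_of_sign _ _ ((hz2 _).trans (hz2 _).symm)
  have e1 := transfer u z hu hzr (ne_of_sign _ _ (hz2 _)) fun n => by
    simp only [hz]
    split_ifs with c
    · rw [← c]
      exact hab
    · exact c
  have e2 := transfer z _ hzr (const_red a) (ne_of_sign _ _ (hz2 _).symm)
    fun n => ne_of_sign _ _ (hz2 _).symm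
  rw [e2] at e1
  simpa [sub_eq_zero] using e1

/-- A class function is additive in the letters, up to torsion. -/
theorem exists_additive_class (hk : 2 ≤ k) (hm : 2 ≤ m)
    (hshift : ∀ W, IsLoopSeq (2 * m) W → φ (fun n => W (n + 1)) = φ W)
    (hflip : ∀ W, IsLoopSeq (2 * m) W → ∀ c, φ (flip c W) = -φ W)
    (htri : ∀ W : Fin 3 → ℤ → Letter k, (∀ j, IsLoopSeq (2 * m) (W j)) →
      (∀ j, ∀ n : ℤ, 0 ≤ n → n < m → W (finRotate 3 j) n = (W j (2 * m - 1 - n)).inv) →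
      ∑ j, φ (W j) = 0) :
    ∃ (F : Letter k → Q) (C : Q), (∀ x, F x + F x.inv = C) ∧
      ∀ W, IsLoopSeq (2 * m) W →
        m • φ W = ∑ i ∈ Finset.range (2 * m), F (W i) - m • C := by
  obtain ⟨f, hcongr, hf⟩ := exists_word_potential hk hm hflip htri
  set F : Letter k → Q := fun x => f (fun _ => x) with hF
  have hφ : ∀ W, IsLoopSeq (2 * m) W → m • φ W =
      ∑ i ∈ Finset.range m, F (W i) - ∑ i ∈ Finset.range m, F (W (-1 - i)).inv := by
    intro W hW
    rw [hf W hW, smul_sub, potential_additive hk hm hshift hcongr hf (hW.isReducedTo m),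
      potential_additive hk hm hshift hcongr hf ((hW.flip 0).isReducedTo m)]
    simp [hF, flip]
  -- Comparing the formula for `W` with that for its shift, both sums telescope and leave the
  -- letters at `0` and `m`.
  have hE : ∀ W, IsLoopSeq (2 * m) W →
      F (W 0) + F (W 0).inv = F (W m) + F (W m).inv := by
    intro W hW
    have e := congrArg (m • ·) (hshift W hW)
    rw [hφ _ hW, hφ _ (hW.shift 1), sub_eq_sub_iff_sub_eq_sub, ← Finset.sum_sub_distrib,
      ← Finset.sum_sub_distrib] at e
    have t1 := Finset.sum_range_sub (fun i : ℕ => F (W i)) m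
    have t2 := Finset.sum_range_sub' (fun i : ℕ => F (W (-(i : ℤ))).inv) m
    simp only [Nat.cast_add, Nat.cast_one] at t1 t2
    have e' : ∑ i ∈ Finset.range m, (F (W (-1 - i + 1)).inv - F (W (-1 - i)).inv) =
        ∑ i ∈ Finset.range m, (F (W (-i)).inv - F (W (-(i + 1))).inv) := by
      refine Finset.sum_congr rfl fun i _ => ?_
      rw [show -1 - (i : ℤ) + 1 = -i by ring, show -1 - (i : ℤ) = -(i + 1) by ring]
    rw [e', t1, t2] at e
    have hper : W (-(m : ℤ)) = W m := by
      rw [← hW.periodic]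
      congr 1
      push_cast
      ring
    rw [hper] at e
    simp only [Nat.cast_zero, neg_zero] at e
    rw [sub_eq_sub_iff_add_eq_add] at e
    rw [add_comm (F (W 0)), ← e, add_comm]
  have hE' : ∀ x y : Letter k, F x + F x.inv = F y + F y.inv := by
    intro x y
    by_cases hxy : y = x.inv
    · rw [hxy, Letter.inv_inv, add_comm]
    -- The loop `x y ⋯ y` has `x` at position `0` and `y` at position `m`.
    · have hW : IsLoopSeq (2 * m) (fun n : ℤ => (fun j : ℤ => if j = 0 then x else y)
          (n % (2 * m : ℕ))) := by
        refine isLoopSeq_emod (X := fun j => if j = 0 then x else y) (by omega)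
          (fun n hn _ => ?_) ?_
        · dsimp only
          rw [if_neg (show ¬ n + 1 = 0 by omega)]
          split_ifs
          · exact hxy
          · exact y.inv_ne.symm
        · rw [if_pos rfl, if_neg (show ¬ ((2 * m : ℕ) : ℤ) - 1 = 0 by omega)]
          exact fun e => hxy (Letter.eq_inv_comm.1 e)
      have h := hE _ hW
      dsimp only at h
      rwa [if_pos (by simp), if_neg (by
        rw [Int.emod_eq_of_lt (by omega) (by push_cast; omega)]
        omega)] at h
  refine ⟨F, _, fun x => hE' x (⟨0, by omega⟩, true), fun W hW => ?_⟩
  generalize hC : F (⟨0, by omega⟩, true) + F (Letter.inv (⟨0, by omega⟩, true)) = C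
  have hinv : ∀ x : Letter k, F x.inv = C - F x := by
    intro x
    rw [← hC, ← hE' x, add_sub_cancel_left]
  rw [hφ W hW]
  simp only [hinv]
  rw [Finset.sum_sub_distrib, two_mul, Finset.sum_range_add, ← Finset.sum_range_reflect
    (fun i => F (W ((m + i : ℕ) : ℤ)))]
  have e : ∑ i ∈ Finset.range m, F (W (-1 - i)) =
      ∑ i ∈ Finset.range m, F (W ((m + (m - 1 - i) : ℕ) : ℤ)) := by
    refine Finset.sum_congr rfl fun i hi => ?_
    rw [Finset.mem_range] at hi
    rw [← hW.periodic]
    congr 2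
    push_cast
    omega
  rw [e]
  simp only [Finset.sum_const, Finset.card_range]
  abel

end Additive

end GoodPants

/-! ### Homologically trivial vectors in the group of boundaries. -/

namespace GoodPants

variable {k L : ℕ}

/-- The sign of the generator `x_a` in a letter. -/
def Letter.sign {k : ℕ} (x : Letter k) (a : Fin k) : ℤ :=
  if x.1 = a then (if x.2 then 1 else -1) else 0

theorem sum_sign (x : Letter k) : ∑ a, x.sign a = 1 - 2 * (if x.2 then 0 else 1) := by
  simp only [Letter.sign, Finset.sum_ite_eq, Finset.mem_univ, if_true]
  split_ifs <;> rfl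

theorem Letter.sign_inv (x : Letter k) (a : Fin k) : x.inv.sign a = -x.sign a := by
  obtain ⟨b, σ⟩ := x
  cases σ <;> simp only [sign, inv] <;> split_ifs <;> simp_all

theorem letter_function_eq {Q : Type*} [AddCommGroup Q] {F : Letter k → Q} {C : Q}
    (hF : ∀ x, F x + F x.inv = C) (x : Letter k) :
    F x = ∑ a, x.sign a • F (a, true) + (if x.2 then 0 else 1 : ℤ) • C := by
  obtain ⟨b, σ⟩ := x
  rw [Finset.sum_eq_single b (fun a _ h => by simp [Letter.sign, h.symm]) (by simp)]
  cases σ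
  · have h := hF (b, true)
    simp only [Letter.inv, Bool.not_true] at h
    simp [Letter.sign, ← h]
  · simp [Letter.sign]

/-- A class of loops that is additive in the letters only depends on the homology. -/
theorem nsmul_map_eq_zero {Q : Type*} [AddCommGroup Q] (π : (TaggedLoop k L → ℤ) →+ Q)
    {F : Letter k → Q} {C : Q} {m : ℕ} (hL : L = 2 * m) (hF : ∀ x, F x + F x.inv = C)
    (hπ : ∀ s, m • π (Pi.single s 1) = ∑ i, F (s.word i) - m • C)
    {z : TaggedLoop k L → ℤ} (hz : ∀ a, ∑ s, z s * s.homology a = 0) : m • π z = 0 := by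
  -- The number of inverse generators in the word; with the length fixed, the total exponent sum
  -- determines it.
  set ν : TaggedLoop k L → ℤ := fun s => ∑ i, if (s.word i).2 then 0 else 1 with hν
  have hclass : ∀ s : TaggedLoop k L, m • π (Pi.single s 1) =
      ∑ a, s.homology a • F (a, true) + (ν s - m) • C := by
    intro s
    rw [hπ, Finset.sum_congr rfl fun i _ => letter_function_eq hF (s.word i),
      Finset.sum_add_distrib, Finset.sum_comm, sub_smul, ← Finset.sum_smul]
    simp only [← Finset.sum_smul]
    rw [natCast_zsmul, add_sub_assoc]
    rfl
  have hν2 : ∀ s : TaggedLoop k L, 2 * (ν s - m) = -∑ a, s.homology a := by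
    intro s
    have : ∑ a, s.homology a = ∑ i, ∑ a, (s.word i).sign a := Finset.sum_comm
    rw [this, Finset.sum_congr rfl fun i _ => sum_sign (s.word i), Finset.sum_sub_distrib,
      ← Finset.mul_sum]
    simp only [Finset.sum_const, Finset.card_univ, Fintype.card_fin, hν]
    rw [nsmul_eq_mul]
    have : (L : ℤ) = 2 * m := by exact_mod_cast hL
    linarith
  -- Homology directly controls twice this coefficient. The factor `2` is cancelled among integers,
  -- as `C` may be a torsion element.
  have hzν : ∑ s, z s * (ν s - m) = 0 := by
    have : 2 * ∑ s, z s * (ν s - m) = 0 := by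
      rw [Finset.mul_sum]
      calc ∑ s, 2 * (z s * (ν s - m)) = ∑ s, ∑ a, -(z s * s.homology a) := by
            refine Finset.sum_congr rfl fun s _ => ?_
            rw [mul_left_comm, hν2, Finset.sum_neg_distrib, ← Finset.mul_sum]
            ring
        _ = 0 := by
            rw [Finset.sum_comm]
            exact Finset.sum_eq_zero fun a _ => by rw [Finset.sum_neg_distrib, hz, neg_zero]
    omega
  have hsum : z = ∑ s, z s • (Pi.single s 1 : TaggedLoop k L → ℤ) := by
    funext t
    simp [Finset.sum_apply, Pi.single_apply]
  conv_lhs => rw [hsum, map_sum, Finset.smul_sum]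
  calc ∑ s, m • π (z s • (Pi.single s 1 : TaggedLoop k L → ℤ))
      = ∑ s, (∑ a, (z s * s.homology a) • F (a, true) + (z s * (ν s - m)) • C) := by
        refine Finset.sum_congr rfl fun s _ => ?_
        rw [map_zsmul, smul_comm, hclass, smul_add, Finset.smul_sum]
        simp only [mul_smul]
    _ = 0 := by
        rw [Finset.sum_add_distrib, Finset.sum_comm, ← Finset.sum_smul, hzν, zero_smul, add_zero]
        exact Finset.sum_eq_zero fun a _ => by rw [← Finset.sum_smul, hz, zero_smul]

/-- Homologically trivial vectors bound virtually, modulo good annuli. -/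
theorem smul_mem_boundingGroup [NeZero L] {q : ℕ} (hL : L = 4 * q) (hk : 2 ≤ k)
    {z : TaggedLoop k L → ℤ} (hz : ∀ a, ∑ s, z s * s.homology a = 0) :
    (2 * q) • z ∈ boundingGroup k L q := by
  have hL0 := NeZero.ne L
  have hL2 : L = 2 * (2 * q) := by omega
  obtain ⟨F, C, hF, hφ⟩ := exists_additive_class (k := k) (m := 2 * q) (φ := loopClass L q) hk
    (by omega) (fun W hW => loopClass_shift hL hk (hL2 ▸ hW) 1)
    (fun W hW c => loopClass_flip hL hk (hL2 ▸ hW) c)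
    (fun W hW h => loopClass_triangle hL hk (fun j => hL2 ▸ hW j) fun j n hn hn' => by
      rw [h j n hn (by push_cast; exact hn')]
      congr 2
      push_cast
      ring)
  rw [← hL2] at hφ
  rw [← QuotientAddGroup.eq_zero_iff]
  refine nsmul_map_eq_zero (QuotientAddGroup.mk' (boundingGroup k L q)) hL2 hF (fun s => ?_) hz
  rw [QuotientAddGroup.mk'_apply, ← loopClass_seq hL hk, hφ _ s.isLoopSeq, Finset.sum_range]
  simp only [s.seq_natCast]

theorem exists_smul_add_mem_boundingCone [NeZero L] {q : ℕ} (hL : L = 4 * q) (hk : 2 ≤ k)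
    {z : TaggedLoop k L → ℤ} (hz : ∀ a, ∑ s, z s * s.homology a = 0) :
    ∃ n : ℕ, (2 * q) • z + n • 1 ∈ boundingCone k L q :=
  exists_add_mem_of_boundingGroup hL hk (smul_mem_boundingGroup hL hk hz)

theorem exists_smul_one_mem_boundingCone [NeZero L] {q : ℕ} (hL : L = 4 * q) (hk : 2 ≤ k) :
    ∃ n : ℕ, 0 < n ∧ n • (1 : TaggedLoop k L → ℤ) ∈ boundingCone k L q := by
  classical
  refine ⟨2 * (2 * k - 2), by omega, ?_⟩
  rw [← sum_annuli (2 * q)]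
  refine AddSubmonoid.sum_mem _ fun p hp => AddSubmonoid.subset_closure (Or.inl ?_)
  exact ⟨2 * q, p.1, p.2, by omega, by omega, (Finset.mem_filter.1 hp).2, rfl⟩

/-- The image of a loop under the automorphism that inverts all generators. -/
def TaggedLoop.conj (s : TaggedLoop k L) : TaggedLoop k L where
  word i := (s.word i).inv
  tag := s.tag.inv
  reduced i h := s.reduced i (Letter.inv_inj.1 h)
  tag_ne_first i hi h := s.tag_ne_first i hi (Letter.inv_inj.1 h)
  tag_ne_last i hi h := s.tag_ne_last i hi (Letter.inv_inj.1 h)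

theorem TaggedLoop.conj_conj (s : TaggedLoop k L) : s.conj.conj = s := by
  ext1
  · funext i
    exact Letter.inv_inv _
  · exact Letter.inv_inv _

theorem TaggedLoop.homology_conj (s : TaggedLoop k L) (a : Fin k) :
    s.conj.homology a = -s.homology a := by
  unfold homology
  rw [← Finset.sum_neg_distrib]
  refine Finset.sum_congr rfl fun i _ => ?_
  exact Letter.sign_inv (s.word i) a

/-- Inverting all generators permutes the tagged loops and negates homology, so the sum of all
homology classes is its own negative. -/
theorem one_mem_trivialSpace : (1 : LoopSpace k L) ∈ TrivialSpace k L := by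
  rw [LinearMap.mem_ker]
  funext a
  have h : ∑ s : TaggedLoop k L, s.homology a = -∑ s : TaggedLoop k L, s.homology a := by
    rw [← Finset.sum_neg_distrib]
    exact Fintype.sum_bijective TaggedLoop.conj
      (Function.Involutive.bijective TaggedLoop.conj_conj) _ _
      fun s => by rw [s.homology_conj, neg_neg]
  have h' : ∑ s : TaggedLoop k L, s.homology a = 0 := by omega
  simp only [homologyMap, LinearMap.coe_mk, AddHom.coe_mk, Pi.one_apply, one_mul, Pi.zero_apply]
  exact_mod_cast h'

end GoodPants

/-! ### Rational multiples and the neighbourhood of `1`. -/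

namespace GoodPants

variable {k L : ℕ}

theorem BoundsThin.nsmul {u : LoopSpace k L} (hu : BoundsThin u) (n : ℕ) :
    BoundsThin ((n : ℚ) • u) := by
  induction n with
  | zero =>
    rw [Nat.cast_zero, zero_smul]
    exact BoundsThin.zero
  | succ n ih =>
    rw [Nat.cast_succ, add_smul, one_smul]
    exact ih.add hu

/-- A positive rational multiple of the vector bounds a thin fatgraph. -/
def BoundsThinVirtually (u : LoopSpace k L) : Prop :=
  ∃ c : ℚ, 0 < c ∧ BoundsThin (c • u)

theorem BoundsThin.virtually {u : LoopSpace k L} (hu : BoundsThin u) : BoundsThinVirtually u :=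
  ⟨1, one_pos, by rwa [one_smul]⟩

namespace BoundsThinVirtually

theorem exists_nat {u : LoopSpace k L} (hu : BoundsThinVirtually u) :
    ∃ n : ℕ, 0 < n ∧ BoundsThin ((n : ℚ) • u) := by
  obtain ⟨c, hc, h⟩ := hu
  -- The numerator is the denominator times `c`, so it corresponds to taking that many copies of the
  -- fatgraph.
  refine ⟨c.num.toNat, by have := Rat.num_pos.2 hc; omega, ?_⟩
  have e : ((c.num.toNat : ℕ) : ℚ) = c.den * c := by
    rw [Rat.den_mul_eq_num]
    exact_mod_cast Int.toNat_of_nonneg (Rat.num_pos.2 hc).le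
  rw [e, mul_smul]
  exact h.nsmul _

theorem add {u v : LoopSpace k L} (hu : BoundsThinVirtually u) (hv : BoundsThinVirtually v) :
    BoundsThinVirtually (u + v) := by
  obtain ⟨m, hm, hu⟩ := hu.exists_nat
  obtain ⟨n, hn, hv⟩ := hv.exists_nat
  refine ⟨(m : ℚ) * n, by positivity, ?_⟩
  have h := (hu.nsmul n).add (hv.nsmul m)
  rwa [← mul_smul, ← mul_smul, mul_comm (n : ℚ), ← smul_add] at h

theorem smul {u : LoopSpace k L} (hu : BoundsThinVirtually u) {a : ℚ} (ha : 0 ≤ a) :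
    BoundsThinVirtually (a • u) := by
  rcases ha.eq_or_lt with rfl | ha
  · rw [zero_smul]
    exact BoundsThin.zero.virtually
  · obtain ⟨c, hc, h⟩ := hu
    refine ⟨c / a, by positivity, ?_⟩
    rwa [← mul_smul, div_mul_cancel₀ _ ha.ne']

theorem sum {ι : Type*} (s : Finset ι) {u : ι → LoopSpace k L}
    (hu : ∀ i ∈ s, BoundsThinVirtually (u i)) : BoundsThinVirtually (∑ i ∈ s, u i) := by
  classical
  induction s using Finset.induction_on with
  | empty => exact BoundsThin.zero.virtually
  | insert i s hi ih =>
    rw [Finset.sum_insert hi]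
    exact (hu i (Finset.mem_insert_self i s)).add
      (ih fun j hj => hu j (Finset.mem_insert_of_mem hj))

end BoundsThinVirtually

theorem sum_homology_eq_zero (v : TrivialSpace k L) (a : Fin k) :
    ∑ s, (v : LoopSpace k L) s * s.homology a = 0 :=
  congrFun (LinearMap.mem_ker.1 v.2) a

section Bounding

variable {q : ℕ} (hL : L = 4 * q) (hk : 2 ≤ k) (hL0 : 0 < L)

include hL hk hL0

theorem exists_bounds_of_integral (v : TrivialSpace k L)
    (hv : ∀ s, ∃ z : ℤ, (v : LoopSpace k L) s = (z : ℚ)) :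
    ∃ n : ℕ, BoundsPantsAndAnnuli
        (((L : ℚ) / 2) • (v : LoopSpace k L) + (n : ℚ) • (1 : LoopSpace k L)) ∧
      BoundsThin (((L : ℚ) / 2) • (v : LoopSpace k L) + (n : ℚ) • (1 : LoopSpace k L)) := by
  have : NeZero L := ⟨hL0.ne'⟩
  choose z hz using hv
  obtain ⟨n, hn⟩ := exists_smul_add_mem_boundingCone hL hk (z := z) fun a => by
    have h := sum_homology_eq_zero v a
    simp only [hz] at h
    exact_mod_cast h
  have e : ratVector ((2 * q) • z + n • 1) =
      ((L : ℚ) / 2) • (v : LoopSpace k L) + (n : ℚ) • (1 : LoopSpace k L) := by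
    funext s
    simp only [ratVector, Pi.add_apply, Pi.smul_apply, hz, hL, smul_eq_mul, Pi.one_apply]
    rw [nsmul_eq_mul, nsmul_eq_mul]
    push_cast
    ring
  exact ⟨n, e ▸ boundingCone_bounds hL hn⟩

theorem one_boundsThinVirtually : BoundsThinVirtually (1 : LoopSpace k L) := by
  have : NeZero L := ⟨hL0.ne'⟩
  obtain ⟨n, hn, h⟩ := exists_smul_one_mem_boundingCone hL hk
  refine ⟨n, by exact_mod_cast hn, ?_⟩
  have e : ratVector (n • 1) = (n : ℚ) • (1 : LoopSpace k L) := by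
    funext s
    simp [ratVector]
  exact e ▸ (boundingCone_bounds hL h).2

theorem exists_add_one_boundsThinVirtually (v : TrivialSpace k L) :
    ∃ t : ℚ, 0 ≤ t ∧ BoundsThinVirtually ((v : LoopSpace k L) + t • 1) := by
  set d : ℕ := ∏ s, ((v : LoopSpace k L) s).den with hd
  have hd0 : (0 : ℚ) < d := by
    exact_mod_cast Finset.prod_pos fun s _ => ((v : LoopSpace k L) s).pos
  obtain ⟨n, -, h⟩ := exists_bounds_of_integral hL hk hL0 ((d : ℚ) • v) fun s => by
    obtain ⟨e, he⟩ : ((v : LoopSpace k L) s).den ∣ d := Finset.dvd_prod_of_mem _ (Finset.mem_univ s)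
    refine ⟨e * ((v : LoopSpace k L) s).num, ?_⟩
    rw [he, Submodule.coe_smul, Pi.smul_apply, smul_eq_mul]
    push_cast
    rw [mul_comm _ (e : ℚ), mul_assoc, Rat.den_mul_eq_num]
  have hc : (0 : ℚ) < L / 2 * d := by positivity
  refine ⟨n / (L / 2 * d), by positivity, L / 2 * d, hc, ?_⟩
  rwa [smul_add, ← mul_smul, mul_div_cancel₀ _ hc.ne', mul_smul]

/-- The projective neighbourhood of `1` in which all vectors are positive and bound virtually. -/
theorem exists_open_subset_thinCone :
    ∃ U : Set (TrivialSpace k L), IsOpen U ∧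
      (⟨1, one_mem_trivialSpace⟩ : TrivialSpace k L) ∈ U ∧
      (∀ c : ℚ, 0 < c → ∀ v ∈ U, c • v ∈ U) ∧ U ⊆ thinCone k L := by
  have : NeZero L := ⟨hL0.ne'⟩
  set o : TrivialSpace k L := ⟨1, one_mem_trivialSpace⟩ with ho
  obtain ⟨s₀, -⟩ := exists_loop_of_seq (L := L) hk (W := fun _ => ((⟨0, by omega⟩, true) : Letter k))
    ⟨fun _ => rfl, fun _ => (Letter.inv_ne _).symm⟩
  let b := Module.finBasis ℚ (TrivialSpace k L)
  choose t ht htb using exists_add_one_boundsThinVirtually hL hk hL0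
  -- A single multiple of `1` large enough for all basis vectors and their negatives, so
  -- coefficients of either sign can be handled.
  set T : ℚ := ∑ i, (t (b i) + t (-b i)) with hT
  have hT0 : 0 ≤ T := Finset.sum_nonneg fun i _ => add_nonneg (ht _) (ht _)
  have one_mem := one_boundsThinVirtually hL hk hL0
  have mono : ∀ (v : LoopSpace k L) (x y : ℚ), x ≤ y → BoundsThinVirtually (v + x • 1) →
      BoundsThinVirtually (v + y • 1) := by
    intro v x y hxy h
    have := h.add (one_mem.smul (sub_nonneg.2 hxy))
    rwa [add_assoc, ← add_smul, add_sub_cancel] at this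
  have hle : ∀ i, t (b i) ≤ T ∧ t (-b i) ≤ T := by
    intro i
    have := Finset.single_le_sum (f := fun i => t (b i) + t (-b i))
      (fun i _ => add_nonneg (ht _) (ht _)) (Finset.mem_univ i)
    have h1 := ht (b i)
    have h2 := ht (-b i)
    constructor <;> linarith
  have hb : ∀ (i) (a : ℚ),
      BoundsThinVirtually (a • (b i : LoopSpace k L) + (|a| * T) • 1) := by
    intro i a
    rcases le_total 0 a with ha | ha
    · have := (mono _ _ _ (hle i).1 (htb (b i))).smul ha
      rw [abs_of_nonneg ha]
      rwa [smul_add, ← mul_smul] at this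
    · have := (mono _ _ _ (hle i).2 (htb (-b i))).smul (neg_nonneg.2 ha)
      rw [abs_of_nonpos ha]
      rwa [smul_add, ← mul_smul, Submodule.coe_neg, smul_neg, neg_smul, neg_neg] at this
  have cont : ∀ f : TrivialSpace k L →ₗ[ℚ] ℚ, Continuous f := by
    intro f
    obtain ⟨g, hg⟩ := f.exists_extend
    rw [← hg]
    exact g.continuous_on_pi.comp continuous_subtype_val
  -- A linear functional with value `1` on `1`; `β i` are the coordinates of `v - ℓ v • 1`.
  let ℓ : TrivialSpace k L →ₗ[ℚ] ℚ := (LinearMap.proj s₀).comp (Submodule.subtype _)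
  have hℓ : ∀ v : TrivialSpace k L, ℓ v = (v : LoopSpace k L) s₀ := fun _ => rfl
  let β : Fin (Module.finrank ℚ (TrivialSpace k L)) → TrivialSpace k L →ₗ[ℚ] ℚ :=
    fun i => (b.coord i).comp (LinearMap.id - ℓ.smulRight o)
  have hβ : ∀ i v, β i v = b.coord i (v - ℓ v • o) := fun _ _ => rfl
  -- Writing `v = ∑ β i v • b i + ℓ v • 1`, the basis part needs at most `∑ |β i v| * T` copies of
  -- `1`, and `ℓ v` supplies more. Both sides scale under positive factors, and at `1` the
  -- inequality reads `0 < 1`.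
  refine ⟨{v | (∀ s, 0 < (v : LoopSpace k L) s) ∧ ∑ i, |β i v| * T < ℓ v}, ?_, ?_, ?_, ?_⟩
  · rw [Set.ofPred_and, Set.ofPred_forall]
    refine (isOpen_iInter_of_finite fun s => ?_).inter (isOpen_lt ?_ (cont ℓ))
    · exact isOpen_lt continuous_const ((continuous_apply s).comp continuous_subtype_val)
    · exact continuous_finsetSum _ fun i _ => (cont (β i)).abs.mul continuous_const
  · refine ⟨fun s => zero_lt_one, ?_⟩
    have h1 : ℓ o = 1 := rfl
    simp [hβ, h1]
  · rintro c hc v ⟨h1, h2⟩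
    refine ⟨fun s => mul_pos hc (h1 s), ?_⟩
    simp only [map_smul, smul_eq_mul, abs_mul, abs_of_pos hc, mul_assoc]
    rw [← Finset.mul_sum]
    exact mul_lt_mul_of_pos_left h2 hc
  · rintro v ⟨h1, h2⟩
    refine ⟨h1, ?_⟩
    have h := BoundsThinVirtually.sum Finset.univ fun i _ => hb i (β i v)
    rw [Finset.sum_add_distrib, ← Finset.sum_smul] at h
    have h' := mono _ _ _ h2.le h
    have e : ∑ i, β i v • (b i : LoopSpace k L) = v - ℓ v • 1 := by
      have := congrArg Subtype.val (b.sum_repr (v - ℓ v • o))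
      rw [Submodule.coe_sum] at this
      exact this
    rwa [e, sub_add_cancel] at h'

end Bounding

/-- An open set spans the space of homologically trivial vectors. -/
theorem affineSpan_eq_top_of_isOpen_subset {U A : Set (TrivialSpace k L)} (hU : IsOpen U)
    {o : TrivialSpace k L} (ho : o ∈ U) (hUA : U ⊆ A) : affineSpan ℚ A = ⊤ := by
  rw [eq_top_iff]
  rintro p -
  have hc : Continuous fun ε : ℚ => o + ε • (p - o) := by
    refine Continuous.subtype_mk (f := fun ε : ℚ => (o + ε • (p - o) : LoopSpace k L)) ?_ _
    fun_prop
  -- For a small nonzero `ε` this point lies in `U`, and `p` lies on the line through it and `o`.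
  have h0 : ∀ᶠ ε in nhds (0 : ℚ), o + ε • (p - o) ∈ U :=
    hc.continuousAt.eventually_mem (hU.mem_nhds (by simpa using ho))
  obtain ⟨ε, hε, hε0⟩ := ((h0.filter_mono nhdsWithin_le_nhds).and
    (self_mem_nhdsWithin (s := {0}ᶜ))).exists
  have h := AffineMap.lineMap_mem (k := ℚ) ε⁻¹ (subset_affineSpan ℚ A (hUA ho))
    (subset_affineSpan ℚ A (hUA hε))
  have e : AffineMap.lineMap o (o + ε • (p - o)) ε⁻¹ = p := by
    rw [AffineMap.lineMap_apply, vsub_eq_sub, vadd_eq_add, add_sub_cancel_left, smul_smul,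
      inv_mul_cancel₀ hε0, one_smul, sub_add_cancel]
  rwa [e] at h

end GoodPants

theorem proposition4p1p3 (k L : ℕ) (hk : 2 ≤ k) (hL : 0 < L) (hL4 : 4 ∣ L) :
    (∀ v : GoodPants.TrivialSpace k L,
      (∀ s, ∃ z : ℤ, (v : GoodPants.LoopSpace k L) s = (z : ℚ)) →
      ∃ n : ℕ, GoodPants.BoundsPantsAndAnnuli
        (((L : ℚ) / 2) • (v : GoodPants.LoopSpace k L) +
          (n : ℚ) • (1 : GoodPants.LoopSpace k L))) ∧
    affineSpan ℚ (GoodPants.thinCone k L) = ⊤ ∧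
    ∃ h1 : (1 : GoodPants.LoopSpace k L) ∈ GoodPants.TrivialSpace k L,
      ∃ U : Set (GoodPants.TrivialSpace k L), IsOpen U ∧
        (⟨1, h1⟩ : GoodPants.TrivialSpace k L) ∈ U ∧
        (∀ c : ℚ, 0 < c → ∀ v ∈ U, c • v ∈ U) ∧
        U ⊆ GoodPants.thinCone k L := by
  obtain ⟨q, hq⟩ := hL4
  obtain ⟨U, hU, h1, hsmul, hsub⟩ := GoodPants.exists_open_subset_thinCone hq hk hL
  refine ⟨fun v hv => ?_, GoodPants.affineSpan_eq_top_of_isOpen_subset hU h1 hsub,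
    GoodPants.one_mem_trivialSpace, U, hU, h1, hsmul, hsub⟩
  obtain ⟨n, hn, -⟩ := GoodPants.exists_bounds_of_integral hq hk hL v hv
  exact ⟨n, hn⟩
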